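/- Let $X$, $Y$, $\partial X$ be complex Banach spaces with $Y$ continuously imbedded in $X$; let $A:D(A)\subset X\to X$ be linear with $D(A)\subset Y$, and let $L:D(A)\to\partial X$ be linear and surjective. Let $A_0:=A|_{\ker L}$ be closed, densely defined in $X$ and with nonempty resolvent set, and let $\binom{A}{L}:D(A)\to X\times\partial X$ be closed. Let $B:D(A)\to\partial X$ be linear with $\|Bu\|\le c\,(\|u\|_X+\|Au\|_X+\|Lu\|_{\partial X})$ for all $u\in D(A)$ and some $c$, and let $\tilde B$ be a bounded linear operator on $\partial X$. Assume that $L$ is not bounded from $Y$ to $\partial X$, i.e. there is no $c$ with $\|Lu\|_{\partial X}\le c\|u\|_Y$ for all $u\in D(A)$. On $\mathcal X:=X\times\partial X$ consider $$\mathcal A:=\begin{pmatrix}A&0\\ B&\tilde B\end{pmatrix},\qquad D(\mathcal A):=\Big\{\tbinom{u}{x}\in D(A)\times\partial X:\ Lu=x\Big\},$$ and let $\mathcal Y:=Y\times\partial X$. An operator $K$ on a Banach space $E$ generates a cosine operator function with associated phase space $F\times E$ if the following two conditions hold. (i) There is a strongly continuous $C:\mathbb R\to\mathcal L(E)$ with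 $C(0)=I$ and $C(t+s)+C(t-s)=2C(t)C(s)$ for all $t,s\in\mathbb R$, such that $Kx=\lim_{t\to0}\frac{2}{t^2}(C(t)x-x)$, where $D(K)$ is the set of all $x$ for which this limit exists. (ii) $F$ is a Banach space with continuous and dense imbeddings $[D(K)]\hookrightarrow F\hookrightarrow E$ (where $[D(K)]$ carries the graph norm), and $\begin{pmatrix}0&I_F\\K&0\end{pmatrix}$ with domain $D(K)\times F$ generates a strongly continuous semigroup on $F\times E$. Then $\mathcal A$ generates a cosine operator function with associated phase space $\mathcal Y\times\mathcal X$ if and only if $A_0$ generates a cosine operator function with associated phase space $Y\times X$. Moreover, the first property is equivalent to well-posedness of the problem with dynamical boundary conditions $$\ddot u(t)=Au(t),\quad \ddot x(t)=Bu(t)+\tilde Bx(t),\quad x(t)=Lu(t)\quad(t\in\mathbb R),$$ $$u(0)=f,\quad \dot u(0)=g,\quad x(0)=h,\quad \dot x(0)=k,$$ and the second one is equivalent to well-posedness of the problem with homogeneous boundary conditions $\ddot u(t)=Au(t)$, $Lu(t)=0$ $(t\in\mathbb R)$, $u(0)=f$, $\dot u(0)=g$; hence one of these problems is well-posed if and only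 if the other is. Here well-posedness means the following. For all $f\in D(A)$, $g\in Y$, $h,k\in\partial X$ with $Lf=h$ (respectively, all $f\in D(A_0)$, $g\in Y$) there is exactly one classical solution, that is, one with $u\in C^2(\mathbb R,X)\cap C^1(\mathbb R,Y)$, $u(t)\in D(A)$ for all $t$, and $Lu\in C^2(\mathbb R,\partial X)$. Moreover, it depends continuously on the data in the norm of the phase space: for every $r>0$ there is $M$ such that every classical solution satisfies, for $|t|\le r$, $$\|u(t)\|_Y+\|\dot u(t)\|_X+\|Lu(t)\|_{\partial X}+\|(Lu)^{\cdot}(t)\|_{\partial X}\le M\big(\|u(0)\|_Y+\|\dot u(0)\|_X+\|Lu(0)\|_{\partial X}+\|(Lu)^{\cdot}(0)\|_{\partial X}\big)$$ (the terms containing $L$ vanish in the homogeneous case). -/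

import Mathlib

open Filter Topology

noncomputable section

namespace DynBdry

section General

variable {E F : Type*} [NormedAddCommGroup E] [NormedSpace ℂ E]
  [NormedAddCommGroup F] [NormedSpace ℂ F]

/-- The resolvent set of an unbounded operator `K`: those `μ` for which `μ - K : D(K) → E` is
bijective with a bounded inverse `R`. -/
def resolventSet (K : E →ₗ.[ℂ] E) : Set ℂ :=
  {μ | ∃ R : E →L[ℂ] E,
    (∀ x : E, ∃ h : R x ∈ K.domain, μ • R x - K ⟨R x, h⟩ = x) ∧
    (∀ u : K.domain, R (μ • (u : E) - K u) = u)}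

/-- Strongly continuous semigroups; only the values at `t ≥ 0` matter. -/
structure IsC0Semigroup (T : ℝ → E →L[ℂ] E) : Prop where
  map_zero : T 0 = ContinuousLinearMap.id ℂ E
  map_add : ∀ s t : ℝ, 0 ≤ s → 0 ≤ t → T (s + t) = (T s).comp (T t)
  strongly_continuous : ∀ x : E, ContinuousOn (fun t : ℝ => T t x) (Set.Ici 0)

/-- `G` is the generator of the semigroup `T`: the graph of `G` consists of all `(x, y)` such that
`(T t x - x) / t → y` as `t ↓ 0`. -/
def IsSemigroupGenerator (T : ℝ → E →L[ℂ] E) (G : E →ₗ.[ℂ] E) : Prop :=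
  ∀ x y : E, (x, y) ∈ G.graph ↔
    Tendsto (fun t : ℝ => t⁻¹ • (T t x - x)) (𝓝[>] 0) (𝓝 y)

/-- Cosine operator functions: strongly continuous solutions of the D'Alembert functional
relations. -/
structure IsCosineFunction (C : ℝ → E →L[ℂ] E) : Prop where
  strongly_continuous : ∀ x : E, Continuous (fun t : ℝ => C t x)
  dalembert : ∀ t s : ℝ, C (t + s) + C (t - s) = (2 : ℂ) • (C t).comp (C s)
  map_zero : C 0 = ContinuousLinearMap.id ℂ E

/-- `K` is the generator of the cosine operator function `C`: the graph of `K` consists of all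
`(x, y)` such that `2 / t ^ 2 * (C t x - x) → y` as `t → 0`. -/
def IsCosineGenerator (C : ℝ → E →L[ℂ] E) (K : E →ₗ.[ℂ] E) : Prop :=
  ∀ x y : E, (x, y) ∈ K.graph ↔
    Tendsto (fun t : ℝ => (2 / t ^ 2) • (C t x - x)) (𝓝[≠] 0) (𝓝 y)

/-- The operator `K` generates a cosine operator function on `E`. -/
def GeneratesCosine (K : E →ₗ.[ℂ] E) : Prop :=
  ∃ C : ℝ → E →L[ℂ] E, IsCosineFunction C ∧ IsCosineGenerator C K

/-- The reduction matrix `(0 I; K 0)` on `F × E`, with domain `D(K) × F`, where `F` is embedded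
into `E` by the injective map `i` (so `D(K)` stands for `{w : F | i w ∈ D(K)}` in the first
coordinate, and `F` for the range of `i` in the second one). -/
def reductionMatrix (K : E →ₗ.[ℂ] E) (i : F →L[ℂ] E) (hi : Function.Injective i) :
    (F × E) →ₗ.[ℂ] (F × E) where
  domain := (K.domain.comap (i : F →ₗ[ℂ] E)).prod (LinearMap.range (i : F →ₗ[ℂ] E))
  toFun :=
    { toFun := fun p =>
        ((LinearEquiv.ofInjective (i : F →ₗ[ℂ] E) hi).symm ⟨p.1.2, p.2.2⟩, K ⟨i p.1.1, p.2.1⟩)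
      map_add' := by
        rintro ⟨⟨u, v⟩, hu, hv⟩ ⟨⟨u', v'⟩, hu', hv'⟩
        refine Prod.ext ?_ ?_
        · exact (LinearEquiv.ofInjective (i : F →ₗ[ℂ] E) hi).symm.map_add ⟨v, hv⟩ ⟨v', hv'⟩
        · change K ⟨i (u + u'), _⟩ = K ⟨i u, hu⟩ + K ⟨i u', hu'⟩
          rw [← LinearPMap.map_add]
          congr 1
          exact Subtype.ext (map_add i u u')
      map_smul' := by
        rintro c ⟨⟨u, v⟩, hu, hv⟩
        refine Prod.ext ?_ ?_
        · exact (LinearEquiv.ofInjective (i : F →ₗ[ℂ] E) hi).symm.map_smul c ⟨v, hv⟩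
        · change K ⟨i (c • u), _⟩ = c • K ⟨i u, hu⟩
          rw [← LinearPMap.map_smul]
          congr 1
          exact Subtype.ext (map_smul i c u) }

/-- `F`, embedded by `i` into `E`, is a Kisyński space for `K`: the imbeddings
`[D(K)] ↪ F ↪ E` are continuous and dense, and the reduction matrix generates a strongly
continuous semigroup on `F × E`. -/
structure IsKisynskiSpace (K : E →ₗ.[ℂ] E) (i : F →L[ℂ] E) (hi : Function.Injective i) :
    Prop where
  domain_le : ∀ u ∈ K.domain, ∃ w : F, i w = u
  bounded : ∃ c : ℝ, ∀ (w : F) (h : i w ∈ K.domain), ‖w‖ ≤ c * (‖i w‖ + ‖K ⟨i w, h⟩‖)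
  dense_domain : Dense {w : F | i w ∈ K.domain}
  dense_range : DenseRange i
  generates : ∃ T : ℝ → (F × E) →L[ℂ] (F × E),
    IsC0Semigroup T ∧ IsSemigroupGenerator T (reductionMatrix K i hi)

/-- `K` generates a cosine operator function with associated phase space `F × E`. -/
def GeneratesCosineWithPhaseSpace (K : E →ₗ.[ℂ] E) (i : F →L[ℂ] E)
    (hi : Function.Injective i) : Prop :=
  GeneratesCosine K ∧ IsKisynskiSpace K i hi

/-- Classical solutions `u ∈ C²(ℝ, E) ∩ C¹(ℝ, F)` of `u'' = K u`. -/
structure IsClassicalSolution (K : E →ₗ.[ℂ] E) (i : F →L[ℂ] E) (u : ℝ → F) : Prop where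
  contDiff_one : ContDiff ℝ 1 u
  contDiff_two : ContDiff ℝ 2 (fun t => i (u t))
  equation : ∀ t : ℝ, ∃ h : i (u t) ∈ K.domain,
    deriv (deriv fun s => i (u s)) t = K ⟨i (u t), h⟩

/-- Well-posedness of `u'' = K u`, `u(0) = f ∈ D(K)`, `u'(0) = g ∈ F`: existence and uniqueness of
classical solutions, and continuous dependence on the data, locally uniformly in time, in the norm
of the phase space `F × E`. -/
def IsWellPosed (K : E →ₗ.[ℂ] E) (i : F →L[ℂ] E) : Prop :=
  (∀ (f : K.domain) (g : F),
    ∃! u : ℝ → F, IsClassicalSolution K i u ∧ i (u 0) = f ∧ deriv u 0 = g) ∧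
  (∀ r : ℝ, ∃ M : ℝ, ∀ u : ℝ → F, IsClassicalSolution K i u → ∀ t : ℝ, |t| ≤ r →
    ‖u t‖ + ‖i (deriv u t)‖ ≤ M * (‖u 0‖ + ‖i (deriv u 0)‖))

end General

section Boundary

variable {X Y Z : Type*} [NormedAddCommGroup X] [NormedSpace ℂ X]
  [NormedAddCommGroup Y] [NormedSpace ℂ Y] [NormedAddCommGroup Z] [NormedSpace ℂ Z]

/-- The operator `(A, L) : D(A) → X × Z`, where `Z` is the boundary space. -/
def pairOp (A : X →ₗ.[ℂ] X) (L : A.domain →ₗ[ℂ] Z) : X →ₗ.[ℂ] (X × Z) where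
  domain := A.domain
  toFun := A.toFun.prod L

/-- The restriction `A₀` of `A` to `ker L`. -/
def kerRestrict (A : X →ₗ.[ℂ] X) (L : A.domain →ₗ[ℂ] Z) : X →ₗ.[ℂ] X :=
  A.domRestrict ((LinearMap.ker L).map A.domain.subtype)

/-- The operator matrix `(A 0; B B')` on `X × Z` with coupled domain
`{(u, x) ∈ D(A) × Z : L u = x}`. -/
def coupledMatrix (A : X →ₗ.[ℂ] X) (L B : A.domain →ₗ[ℂ] Z) (B' : Z →L[ℂ] Z) :
    (X × Z) →ₗ.[ℂ] (X × Z) where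
  domain :=
    { carrier := {p | ∃ h : p.1 ∈ A.domain, L ⟨p.1, h⟩ = p.2}
      zero_mem' := ⟨A.domain.zero_mem, L.map_zero⟩
      add_mem' := by
        rintro ⟨u, x⟩ ⟨v, y⟩ ⟨hu, hx⟩ ⟨hv, hy⟩
        exact ⟨A.domain.add_mem hu hv,
          (L.map_add ⟨u, hu⟩ ⟨v, hv⟩).trans (congrArg₂ (· + ·) hx hy)⟩
      smul_mem' := by
        rintro c ⟨u, x⟩ ⟨hu, hx⟩
        exact ⟨A.domain.smul_mem c hu,
          (L.map_smul c ⟨u, hu⟩).trans (congrArg (c • ·) hx)⟩ }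
  toFun :=
    { toFun := fun p => (A ⟨p.1.1, p.2.1⟩, B ⟨p.1.1, p.2.1⟩ + B' p.1.2)
      map_add' := by
        rintro ⟨⟨u, x⟩, hu, hx⟩ ⟨⟨v, y⟩, hv, hy⟩
        refine Prod.ext ?_ ?_
        · exact A.map_add ⟨u, hu⟩ ⟨v, hv⟩
        · change B (⟨u, hu⟩ + ⟨v, hv⟩) + B' (x + y) = (B ⟨u, hu⟩ + B' x) + (B ⟨v, hv⟩ + B' y)
          rw [map_add, map_add]
          abel
      map_smul' := by
        rintro c ⟨⟨u, x⟩, hu, hx⟩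
        refine Prod.ext ?_ ?_
        · exact A.map_smul c ⟨u, hu⟩
        · change B (c • ⟨u, hu⟩) + B' (c • x) = c • (B ⟨u, hu⟩ + B' x)
          rw [map_smul, map_smul, smul_add] }

/-- The imbedding `Y × Z ↪ X × Z` induced by an imbedding `Y ↪ X`. -/
def productEmbedding (Z : Type*) [NormedAddCommGroup Z] [NormedSpace ℂ Z] (j : Y →L[ℂ] X) :
    (Y × Z) →L[ℂ] (X × Z) :=
  j.prodMap (ContinuousLinearMap.id ℂ Z)

theorem productEmbedding_injective (Z : Type*) [NormedAddCommGroup Z] [NormedSpace ℂ Z]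
    {j : Y →L[ℂ] X} (hj : Function.Injective j) :
    Function.Injective (productEmbedding Z j) :=
  Function.Injective.prodMap hj Function.injective_id

/-- Classical solutions of the problem with dynamical boundary conditions
`u'' = A u`, `x'' = B u + B' x`, `x = L u` on `ℝ`:
`u ∈ C²(ℝ, X) ∩ C¹(ℝ, Y)`, `u(t) ∈ D(A)`, and `x = L u ∈ C²(ℝ, Z)`. -/
structure IsClassicalSolutionDyn (A : X →ₗ.[ℂ] X) (L B : A.domain →ₗ[ℂ] Z) (B' : Z →L[ℂ] Z)
    (j : Y →L[ℂ] X) (u : ℝ → Y) (x : ℝ → Z) : Prop where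
  contDiff_one : ContDiff ℝ 1 u
  contDiff_two : ContDiff ℝ 2 (fun t => j (u t))
  contDiff_boundary : ContDiff ℝ 2 x
  equation : ∀ t : ℝ, ∃ h : j (u t) ∈ A.domain,
    x t = L ⟨j (u t), h⟩ ∧
    deriv (deriv fun s => j (u s)) t = A ⟨j (u t), h⟩ ∧
    deriv (deriv x) t = B ⟨j (u t), h⟩ + B' (x t)

/-- Well-posedness of the problem with dynamical boundary conditions: for all `f ∈ D(A)`, `g ∈ Y`,
`h, k ∈ Z` with `L f = h` there is a unique classical solution `u` with `u(0) = f`, `u'(0) = g`,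
`(L u)(0) = h`, `(L u)'(0) = k`, and it depends continuously on the data, locally uniformly in
time, in the norms of `Y`, `X`, `Z` and `Z`, respectively. -/
def IsWellPosedDyn (A : X →ₗ.[ℂ] X) (L B : A.domain →ₗ[ℂ] Z) (B' : Z →L[ℂ] Z)
    (j : Y →L[ℂ] X) : Prop :=
  (∀ (f : A.domain) (g : Y) (h k : Z), L f = h →
    ∃! u : ℝ → Y, ∃ x : ℝ → Z, IsClassicalSolutionDyn A L B B' j u x ∧
      j (u 0) = f ∧ deriv u 0 = g ∧ x 0 = h ∧ deriv x 0 = k) ∧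
  (∀ r : ℝ, ∃ M : ℝ, ∀ (u : ℝ → Y) (x : ℝ → Z), IsClassicalSolutionDyn A L B B' j u x →
    ∀ t : ℝ, |t| ≤ r →
      ‖u t‖ + ‖j (deriv u t)‖ + ‖x t‖ + ‖deriv x t‖ ≤
        M * (‖u 0‖ + ‖j (deriv u 0)‖ + ‖x 0‖ + ‖deriv x 0‖))

end Boundary

end DynBdry

end

open Filter Topology

/-! Write `K` for an operator on `E` and `i : F → E` for the imbedding. Both notions in the theorem
are reduced to one object, a strongly continuous group on `F × E` generated by the reduction matrix
of `K` (`IsReductionGroup`). For closed `K` with domain inside `F`, such a group is all that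
matters. The reflection `(f, e) ↦ (f, -e)` turns the generator into its negative, so a semigroup is
automatically a group. The lower right entry of the group is the cosine function. The required
density and graph-norm bound follow from density of the generator's domain and from its resolvent
(`generatesCosineWithPhaseSpace_iff`). A well-posed second order problem yields the group by
extending its solution operators by density, and the group conversely yields the solutions
(`generatesCosineWithPhaseSpace_iff_isWellPosed`).

The comparison of `𝒜` with `A₀` is `exists_isReductionGroup_coupledMatrix_iff`. A point `l` of the
resolvent set of `A₀` gives a bounded Dirichlet operator `D : Z → Y` with `A D z = l D z` and `L D z
= z`. The shear `(u, z) ↦ (u - D z, z)` is an isomorphism of both `X × Z` and `Y × Z`, and it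
decouples the domain of `𝒜` into `D(A₀) × Z`. The transformed operator is `diag(A₀, 0) + P`, where
`P` takes values in `Y × Z` and is bounded for the graph norm. The diagonal operator has a reduction
group exactly when `A₀` has one, since the extra block on `Z × Z` is nilpotent.

The analytic core is that `P` does no harm. It enters the reduction matrix `G` as `Q (f, e) = (0, P
f)`, which is unbounded on `F × E` but bounded on `D(G)` with the graph norm. For such `Q`, the sum
`G + Q` is similar to `G + S` with `S` bounded (`exists_relative_perturbation`), and bounded
perturbations are handled by variation of constants. As `P` is also bounded for the graph norm of
the perturbed operator, the step can be reversed. -/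

namespace DynBdry

/-! ### Strongly continuous families of operators -/

section StronglyContinuousFamilies

variable {H H' : Type*} [NormedAddCommGroup H] [NormedSpace ℂ H] [CompleteSpace H]
  [NormedAddCommGroup H'] [NormedSpace ℂ H']

/-- A strongly continuous family of operators is bounded on compact intervals. -/
theorem exists_norm_le_of_stronglyContinuous {W : ℝ → H →L[ℂ] H'}
    (hW : ∀ x, Continuous fun t => W t x) (r : ℝ) :
    ∃ M : ℝ, 1 ≤ M ∧ ∀ t, |t| ≤ r → ‖W t‖ ≤ M := by
  obtain ⟨C, hC⟩ := banach_steinhaus (g := fun t : Set.Icc (-r) r => W t) (fun x => by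
    obtain ⟨C, hC⟩ := (isCompact_Icc (a := -r) (b := r)).exists_bound_of_continuousOn
      (hW x).continuousOn
    exact ⟨C, fun t => hC t t.2⟩)
  exact ⟨max C 1, le_max_right _ _, fun t ht =>
    (hC ⟨t, abs_le.1 ht⟩).trans (le_max_left _ _)⟩

/-- A strongly continuous family of operators is jointly continuous. -/
theorem continuous_uncurry_of_stronglyContinuous {W : ℝ → H →L[ℂ] H'}
    (hW : ∀ x, Continuous fun t => W t x) : Continuous fun p : ℝ × H => W p.1 p.2 := by
  rw [continuous_iff_continuousAt]
  rintro ⟨t₀, x₀⟩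
  obtain ⟨M, -, hM⟩ := exists_norm_le_of_stronglyContinuous hW (|t₀| + 1)
  have h1 : ContinuousAt (fun p : ℝ × H => M * ‖p.2 - x₀‖ + ‖W p.1 x₀ - W t₀ x₀‖) (t₀, x₀) := by
    have := (hW x₀).comp (continuous_fst (X := ℝ) (Y := H))
    have h2 : Continuous fun p : ℝ × H => M * ‖p.2 - x₀‖ + ‖W p.1 x₀ - W t₀ x₀‖ :=
      (continuous_const.mul (continuous_snd.sub continuous_const).norm).add
        ((this.sub continuous_const).norm)
    exact h2.continuousAt
  have h0 : Tendsto (fun p : ℝ × H => M * ‖p.2 - x₀‖ + ‖W p.1 x₀ - W t₀ x₀‖) (𝓝 (t₀, x₀))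
      (𝓝 0) := by simpa [ContinuousAt] using h1
  refine tendsto_iff_norm_sub_tendsto_zero.2 (squeeze_zero' (Eventually.of_forall fun _ =>
    norm_nonneg _) ?_ h0)
  have hev : ∀ᶠ p : ℝ × H in 𝓝 (t₀, x₀), |p.1| < |t₀| + 1 :=
    (continuous_fst.abs.tendsto (t₀, x₀)).eventually_lt_const (by simp)
  filter_upwards [hev] with p hp
  calc ‖W p.1 p.2 - W t₀ x₀‖ = ‖W p.1 (p.2 - x₀) + (W p.1 x₀ - W t₀ x₀)‖ := by
        rw [map_sub]; congr 1; abel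
    _ ≤ ‖W p.1 (p.2 - x₀)‖ + ‖W p.1 x₀ - W t₀ x₀‖ := norm_add_le _ _
    _ ≤ _ := by gcongr; exact (W p.1).le_of_opNorm_le (hM _ hp.le) _

theorem continuous_apply_of_stronglyContinuous {α : Type*} [TopologicalSpace α]
    {W : ℝ → H →L[ℂ] H'} (hW : ∀ x, Continuous fun t => W t x) {f : α → ℝ} {g : α → H}
    (hf : Continuous f) (hg : Continuous g) : Continuous fun a => W (f a) (g a) :=
  (continuous_uncurry_of_stronglyContinuous hW).comp (hf.prodMk hg)

/-- Product rule for a strongly continuous family applied to a curve. -/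
theorem hasDerivAt_apply_of_stronglyContinuous {W : ℝ → H →L[ℂ] H'}
    (hW : ∀ x, Continuous fun t => W t x) {w : ℝ → H} {w' : H} {z : H'} {t : ℝ}
    (hw : HasDerivAt w w' t) (hz : HasDerivAt (fun s => W s (w t)) z t) :
    HasDerivAt (fun s => W s (w s)) (W t w' + z) t := by
  -- `W` need not be differentiable in operator norm, so this part is obtained by applying `W s` to
  -- the difference quotients of `w` and using joint continuity.
  have h1 : HasDerivAt (fun s => W s (w s - w t)) (W t w') t := by
    rw [hasDerivAt_iff_tendsto_slope] at hw ⊢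
    have h2 := ((continuous_uncurry_of_stronglyContinuous hW).tendsto (t, w')).comp
      (((tendsto_id (α := ℝ) (x := 𝓝 t)).mono_left nhdsWithin_le_nhds).prodMk_nhds hw)
    refine h2.congr fun s => ?_
    simp only [Function.comp, id, slope, vsub_eq_sub, sub_self, map_zero, sub_zero]
    rw [← Complex.coe_smul, ← Complex.coe_smul, map_smul]
  refine (h1.add hz).congr_of_eventuallyEq (Eventually.of_forall fun s => ?_)
  simp [map_sub]

/-- The strong integral of a strongly continuous family is a bounded operator. -/
theorem exists_strongIntegral [CompleteSpace H'] {W : ℝ → H →L[ℂ] H'}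
    (hW : ∀ x, Continuous fun t => W t x) (t : ℝ) :
    ∃ I : H →L[ℂ] H', ∀ x, I x = ∫ s in (0 : ℝ)..t, W s x := by
  obtain ⟨M, -, hM⟩ := exists_norm_le_of_stronglyContinuous hW |t|
  refine ⟨LinearMap.mkContinuous
    { toFun := fun x => ∫ s in (0 : ℝ)..t, W s x
      map_add' := fun x y => ?_
      map_smul' := fun c x => ?_ } (M * |t|) fun x => ?_, fun x => rfl⟩
  · simp only [map_add]
    exact intervalIntegral.integral_add ((hW x).intervalIntegrable _ _)
      ((hW y).intervalIntegrable _ _)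
  · simp only [map_smul, RingHom.id_apply]
    exact intervalIntegral.integral_smul _ _
  · have := intervalIntegral.norm_integral_le_of_norm_le_const (a := 0) (b := t)
      (f := fun s => W s x) (C := M * ‖x‖) (fun s hs => (W s).le_of_opNorm_le (hM s ?_) x)
    · simpa [mul_right_comm] using this
    · rcases Set.mem_uIoc.1 hs with h | h
      · rw [abs_of_pos h.1]; exact h.2.trans (le_abs_self _)
      · rw [abs_of_nonpos h.2, abs_of_neg (h.1.trans_le h.2)]; linarith [h.1]

end StronglyContinuousFamilies

/-- The integral of a curve in a closed real subspace stays in the subspace. -/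
theorem integral_mem_of_isClosed {V : Type*} [NormedAddCommGroup V] [NormedSpace ℂ V]
    [CompleteSpace V] (S : Submodule ℂ V) (hS : IsClosed (S : Set V)) {f : ℝ → V}
    (hf : Continuous f) (hfS : ∀ s, f s ∈ S) (t : ℝ) : (∫ s in (0 : ℝ)..t, f s) ∈ S := by
  -- Integrate in `V ⧸ S`, a normed space because `S` is closed; there the integrand vanishes.
  have h1 : (S.mkQ.mkContinuous 1 fun x => by simpa using Submodule.Quotient.norm_mk_le S x)
      (∫ s in (0 : ℝ)..t, f s) = 0 := by
    rw [← ContinuousLinearMap.intervalIntegral_comp_comm _ (hf.intervalIntegrable _ _)]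
    simp [(Submodule.Quotient.mk_eq_zero S).2 (hfS _)]
  simpa using h1

/-! ### One-parameter groups and their generators -/

/-- Strongly continuous one-parameter groups. -/
structure IsC0Group {H : Type*} [NormedAddCommGroup H] [NormedSpace ℂ H]
    (U : ℝ → H →L[ℂ] H) : Prop where
  map_zero : U 0 = ContinuousLinearMap.id ℂ H
  map_add : ∀ s t : ℝ, U (s + t) = (U s).comp (U t)
  strongly_continuous : ∀ x : H, Continuous fun t => U t x

/-- The infinitesimal generator of a family of operators, as a relation. -/
def Gen {H : Type*} [NormedAddCommGroup H] [NormedSpace ℂ H] (U : ℝ → H →L[ℂ] H) (x y : H) :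
    Prop :=
  HasDerivAt (fun t => U t x) y 0

namespace IsC0Group

variable {H : Type*} [NormedAddCommGroup H] [NormedSpace ℂ H] {U : ℝ → H →L[ℂ] H}

theorem apply_zero (hU : IsC0Group U) (x : H) : U 0 x = x := by simp [hU.map_zero]

theorem apply_add (hU : IsC0Group U) (s t : ℝ) (x : H) : U (s + t) x = U s (U t x) := by
  simp [hU.map_add]

theorem apply_neg_apply (hU : IsC0Group U) (t : ℝ) (x : H) : U (-t) (U t x) = x := by
  rw [← hU.apply_add]; simp [hU.map_zero]

theorem apply_apply_neg (hU : IsC0Group U) (t : ℝ) (x : H) : U t (U (-t) x) = x := by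
  rw [← hU.apply_add]; simp [hU.map_zero]

theorem comm (hU : IsC0Group U) (s t : ℝ) (x : H) : U s (U t x) = U t (U s x) := by
  rw [← hU.apply_add, ← hU.apply_add, add_comm]

theorem neg (hU : IsC0Group U) : IsC0Group fun t => U (-t) where
  map_zero := by simp [hU.map_zero]
  map_add s t := by rw [neg_add, hU.map_add]
  strongly_continuous x := (hU.strongly_continuous x).comp continuous_neg

end IsC0Group

section GenBasic

variable {H : Type*} [NormedAddCommGroup H] [NormedSpace ℂ H] {U : ℝ → H →L[ℂ] H}

theorem Gen.unique {x y z : H} (h : Gen U x y) (h' : Gen U x z) : y = z := HasDerivAt.unique h h'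

theorem Gen.add {x y x' y' : H} (h : Gen U x y) (h' : Gen U x' y') :
    Gen U (x + x') (y + y') := by
  simpa [Gen] using HasDerivAt.fun_add h h'

theorem Gen.smul {x y : H} (c : ℂ) (h : Gen U x y) : Gen U (c • x) (c • y) := by
  simpa [Gen] using HasDerivAt.fun_const_smul c h

theorem Gen.sub {x y x' y' : H} (h : Gen U x y) (h' : Gen U x' y') :
    Gen U (x - x') (y - y') := by
  simpa [Gen] using HasDerivAt.fun_sub h h'

theorem Gen.neg {x y : H} (h : Gen U x y) : Gen (fun t => U (-t)) x (-y) := by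
  have h' : HasDerivAt (fun t => U t x) y (-(0 : ℝ)) := by simpa [Gen] using h
  have := h'.scomp (0 : ℝ) (hasDerivAt_neg (0 : ℝ))
  simpa [Gen, Function.comp_def] using this

theorem gen_neg_iff {x y : H} : Gen (fun t => U (-t)) x y ↔ Gen U x (-y) :=
  ⟨fun h => by simpa using h.neg, fun h => by simpa using h.neg⟩

end GenBasic

section GenGroup

variable {H : Type*} [NormedAddCommGroup H] [NormedSpace ℂ H] {U : ℝ → H →L[ℂ] H}

theorem Gen.hasDerivAt (hU : IsC0Group U) {x y : H} (h : Gen U x y) (t : ℝ) :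
    HasDerivAt (fun s => U s x) (U t y) t := by
  have h' : HasDerivAt (fun s => U s x) y (t - t) := by simpa [Gen] using h
  have h1 := h'.comp_sub_const t t
  have h2 := ((U t).restrictScalars ℝ).hasFDerivAt.comp_hasDerivAt t h1
  refine h2.congr_of_eventuallyEq (Eventually.of_forall fun s => ?_)
  change U s x = U t (U (s - t) x)
  rw [← hU.apply_add]; simp

theorem Gen.apply (hU : IsC0Group U) {x y : H} (h : Gen U x y) (t : ℝ) : Gen U (U t x) (U t y) := by
  have h2 := ((U t).restrictScalars ℝ).hasFDerivAt.comp_hasDerivAt 0 h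
  refine h2.congr_of_eventuallyEq (Eventually.of_forall fun s => ?_)
  exact hU.comm s t x

variable [CompleteSpace H]

/-- `U h` translates the interval of integration by `h`, so the fundamental theorem of calculus at
its two ends gives the derivative. -/
theorem gen_integral (hU : IsC0Group U) (x : H) (t : ℝ) :
    Gen U (∫ s in (0 : ℝ)..t, U s x) (U t x - x) := by
  have hc := hU.strongly_continuous x
  have h1 : ∀ h : ℝ, U h (∫ s in (0 : ℝ)..t, U s x)
      = (∫ s in (0 : ℝ)..(t + h), U s x) - ∫ s in (0 : ℝ)..h, U s x := by
    intro h
    rw [← ContinuousLinearMap.intervalIntegral_comp_comm _ (hc.intervalIntegrable _ _)]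
    simp_rw [← hU.apply_add]
    rw [intervalIntegral.integral_comp_add_left (fun s => U s x),
      intervalIntegral.integral_interval_sub_left (hc.intervalIntegrable _ _)
        (hc.intervalIntegrable _ _), add_zero, add_comm]
  have hd : ∀ t : ℝ, HasDerivAt (fun h => ∫ s in (0 : ℝ)..h, U s x) (U t x) t := fun t =>
    intervalIntegral.integral_hasDerivAt_right (hc.intervalIntegrable _ _)
      (hc.stronglyMeasurableAtFilter _ _) hc.continuousAt
  have h2 : HasDerivAt (fun h => ∫ s in (0 : ℝ)..(t + h), U s x) (U t x) 0 := by
    have := (hd (t + 0)).comp_const_add t 0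
    simpa using this
  have h3 := h2.sub (hd 0)
  rw [hU.apply_zero] at h3
  exact h3.congr_of_eventuallyEq (Eventually.of_forall h1)

theorem Gen.integral_eq (hU : IsC0Group U) {x y : H} (h : Gen U x y) (t : ℝ) :
    ∫ s in (0 : ℝ)..t, U s y = U t x - x := by
  have := intervalIntegral.integral_eq_sub_of_hasDerivAt (a := 0) (b := t)
    (fun s _ => h.hasDerivAt hU s) ((hU.strongly_continuous y).intervalIntegrable _ _)
  rw [this, hU.apply_zero]

/-- Generators of strongly continuous groups are densely defined. -/
theorem dense_gen_domain (hU : IsC0Group U) : Dense {x : H | ∃ y, Gen U x y} := by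
  intro x
  have hc := hU.strongly_continuous x
  have hd : HasDerivAt (fun h => ∫ s in (0 : ℝ)..h, U s x) (U 0 x) 0 :=
    intervalIntegral.integral_hasDerivAt_right (hc.intervalIntegrable _ _)
      (hc.stronglyMeasurableAtFilter _ _) hc.continuousAt
  rw [hasDerivAt_iff_tendsto_slope_zero, hU.apply_zero] at hd
  -- The averages `t⁻¹ ∫₀ᵗ U s x` lie in the domain and tend to `x`.
  refine mem_closure_of_tendsto hd (Eventually.of_forall fun t => ?_)
  refine ⟨(t⁻¹ : ℝ) • (U t x - x), ?_⟩
  have := (gen_integral hU x t).smul ((t⁻¹ : ℝ) : ℂ)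
  rw [Complex.coe_smul, Complex.coe_smul] at this
  simpa using this

/-- Curves with values in the domain of the generator that satisfy the abstract Cauchy problem are
orbits of the group. -/
theorem eq_apply_of_hasDerivAt (hU : IsC0Group U) {w w' : ℝ → H}
    (hw : ∀ t, HasDerivAt w (w' t) t) (hg : ∀ t, Gen U (w t) (w' t)) (t : ℝ) :
    w t = U t (w 0) := by
  -- The two contributions of the product rule cancel, so `U (-s) (w s)` is constant.
  have hd : ∀ t, HasDerivAt (fun s => U (-s) (w s)) 0 t := by
    intro t
    have h1 := (hg t).neg.hasDerivAt hU.neg t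
    have h2 := hasDerivAt_apply_of_stronglyContinuous (W := fun s => U (-s))
      hU.neg.strongly_continuous (hw t) h1
    simpa using h2
  have h0 := is_const_of_deriv_eq_zero (fun s => (hd s).differentiableAt)
    (fun s => (hd s).deriv) t 0
  have h1 : U (-t) (w t) = w 0 := by simpa [hU.apply_zero] using h0
  rw [← h1, hU.apply_apply_neg]

/-- A bounded operator intertwining the generators intertwines the groups. -/
theorem intertwine {H' : Type*} [NormedAddCommGroup H'] [NormedSpace ℂ H']
    {V : ℝ → H' →L[ℂ] H'} (hU : IsC0Group U) (hV : IsC0Group V) (N : H' →L[ℂ] H)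
    (hd : Dense {x : H' | ∃ y, Gen V x y}) (hN : ∀ x y, Gen V x y → Gen U (N x) (N y))
    (t : ℝ) (x : H') : N (V t x) = U t (N x) := by
  revert x
  refine hd.induction (P := fun x => N (V t x) = U t (N x)) ?_
    (isClosed_eq (by fun_prop) (by fun_prop))
  rintro x ⟨y, hxy⟩
  have := eq_apply_of_hasDerivAt hU (w := fun t => N (V t x)) (w' := fun t => N (V t y))
    (fun s => (N.restrictScalars ℝ).hasFDerivAt.comp_hasDerivAt s (hxy.hasDerivAt hV s))
    (fun s => hN _ _ (hxy.apply hV s)) t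
  simpa [hV.apply_zero] using this

end GenGroup

/-! ### Resolvents of group generators -/

section Resolvent

variable {H : Type*} [NormedAddCommGroup H] [NormedSpace ℂ H] {U : ℝ → H →L[ℂ] H}

/-- The rescaled group `exp (l t) U(t)`. -/
theorem IsC0Group.rescale (hU : IsC0Group U) (l : ℝ) :
    IsC0Group fun t => ((Real.exp (l * t) : ℝ) : ℂ) • U t where
  map_zero := by simp [hU.map_zero]
  map_add s t := by
    ext x
    simp only [mul_add, Real.exp_add, hU.map_add, Complex.ofReal_mul, smul_apply,
      ContinuousLinearMap.comp_apply, map_smul, smul_smul]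
    rw [mul_comm]
  strongly_continuous x := by
    have := hU.strongly_continuous x
    simp only [smul_apply]
    fun_prop

theorem Gen.rescale (hU : IsC0Group U) (l : ℝ) {x y : H} (h : Gen U x y) :
    Gen (fun t => ((Real.exp (l * t) : ℝ) : ℂ) • U t) x (y + (l : ℂ) • x) := by
  have h1 : HasDerivAt (fun t : ℝ => Real.exp (l * t)) l 0 := by
    simpa using ((hasDerivAt_id (0 : ℝ)).const_mul l).exp
  have h2 := h1.fun_smul h
  simpa [Gen, hU.apply_zero, ← Complex.coe_smul] using h2

theorem gen_rescale_iff (hU : IsC0Group U) (l : ℝ) {x y : H} :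
    Gen (fun t => ((Real.exp (l * t) : ℝ) : ℂ) • U t) x y ↔ Gen U x (y - (l : ℂ) • x) := by
  refine ⟨fun h => ?_, fun h => by simpa using h.rescale hU l⟩
  have h1 := h.rescale (hU.rescale l) (-l)
  have h2 : (fun t => ((Real.exp (-l * t) : ℝ) : ℂ) • ((Real.exp (l * t) : ℝ) : ℂ) • U t) = U := by
    funext t
    rw [smul_smul, ← Complex.ofReal_mul, ← Real.exp_add]
    simp
  rw [h2] at h1
  simpa [sub_eq_add_neg] using h1

/-- `R` is the resolvent at `l` of the generator of `U`. -/
structure IsResolvent (U : ℝ → H →L[ℂ] H) (l : ℝ) (R : H →L[ℂ] H) : Prop where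
  gen : ∀ x, Gen U (R x) ((l : ℂ) • R x - x)
  left_inv : ∀ x y, Gen U x y → R ((l : ℂ) • x - y) = x

variable [CompleteSpace H]

/-- The resolvent of a generator exists at large real numbers, and is small there. -/
theorem exists_isResolvent (hU : IsC0Group U) {ε : ℝ} (hε : 0 < ε) :
    ∃ (l : ℝ) (R : H →L[ℂ] H), IsResolvent U l R ∧ ‖R‖ ≤ ε := by
  obtain ⟨M, hM1, hM⟩ := exists_norm_le_of_stronglyContinuous hU.strongly_continuous 1
  -- The first bound makes `‖W 1‖ ≤ 1 / 2` for the damped group `W t = exp (-l t) U t`, the second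
  -- makes the resolvent smaller than `ε`.
  obtain ⟨l, hl1, hl2⟩ : ∃ l : ℝ, 2 * M ≤ l ∧ 2 * M / ε ≤ l :=
    ⟨max _ _, le_max_left _ _, le_max_right _ _⟩
  have hl : 0 < l := by linarith
  set W : ℝ → H →L[ℂ] H := fun t => ((Real.exp (-l * t) : ℝ) : ℂ) • U t with hWdef
  have hW : IsC0Group W := hU.rescale (-l)
  have hWgen : ∀ x y, Gen W x y ↔ Gen U x (y + (l : ℂ) • x) := fun x y => by
    rw [hWdef, gen_rescale_iff hU (-l)]; simp
  have hWn : ∀ s, 0 ≤ s → s ≤ 1 → ‖W s‖ ≤ M * Real.exp (-l * s) := fun s h0 h1 => by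
    rw [hWdef, norm_smul, Complex.norm_real, Real.norm_of_nonneg (Real.exp_pos _).le, mul_comm]
    gcongr
    exact hM s (by rw [abs_of_nonneg h0]; exact h1)
  -- The resolvent is `(∫₀¹ W s ds) (1 - W 1)⁻¹`: the generator of `W` is that of `U` minus `l`, and
  -- it maps `I x` to `W 1 x - x`. No integral over a half-line is needed.
  obtain ⟨I, hI⟩ := exists_strongIntegral hW.strongly_continuous 1
  have hIn : ∀ x, ‖I x‖ ≤ M / l * ‖x‖ := by
    intro x
    have hder : ∀ s : ℝ, HasDerivAt (fun s => -(M * ‖x‖ / l) * Real.exp (-l * s))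
        (M * ‖x‖ * Real.exp (-l * s)) s := by
      intro s
      have h1 : HasDerivAt (fun s : ℝ => Real.exp (-l * s)) (Real.exp (-l * s) * -l) s := by
        simpa using ((hasDerivAt_id s).const_mul (-l)).exp
      refine (h1.const_mul (-(M * ‖x‖ / l))).congr_deriv ?_
      field_simp
    have hcont : Continuous fun s : ℝ => M * ‖x‖ * Real.exp (-l * s) := by fun_prop
    rw [hI]
    calc ‖∫ s in (0 : ℝ)..1, W s x‖ ≤ ∫ s in (0 : ℝ)..1, M * ‖x‖ * Real.exp (-l * s) := by
          refine intervalIntegral.norm_integral_le_of_norm_le zero_le_one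
            (Eventually.of_forall fun s hs => ?_) (hcont.intervalIntegrable _ _)
          calc ‖W s x‖ ≤ M * Real.exp (-l * s) * ‖x‖ :=
                (W s).le_of_opNorm_le (hWn s hs.1.le hs.2) x
            _ = _ := by ring
      _ = M * ‖x‖ / l * (1 - Real.exp (-l)) := by
          rw [intervalIntegral.integral_eq_sub_of_hasDerivAt (fun s _ => hder s)
            (hcont.intervalIntegrable _ _)]
          simp; ring
      _ ≤ M * ‖x‖ / l * 1 := by
          gcongr
          linarith [Real.exp_pos (-l)]
      _ = M / l * ‖x‖ := by ring
  have hW1 : ‖W 1‖ ≤ 1 / 2 := by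
    refine (hWn 1 zero_le_one le_rfl).trans ?_
    have h1 : l ≤ Real.exp l := by linarith [Real.add_one_le_exp l]
    have h2 : Real.exp (-l * 1) = (Real.exp l)⁻¹ := by rw [mul_one, Real.exp_neg]
    rw [h2, ← div_eq_mul_inv, div_le_iff₀ (Real.exp_pos l)]
    linarith
  obtain ⟨u, hu⟩ := isUnit_one_sub_of_norm_lt_one (x := W 1) (by linarith)
  set N : H →L[ℂ] H := ↑u⁻¹ with hN
  have hN1 : ∀ x, N x - W 1 (N x) = x := fun x => by
    have := congrArg (fun T : H →L[ℂ] H => T x) u.mul_inv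
    rw [hu] at this
    simpa using this
  have hN2 : ∀ x, N (x - W 1 x) = x := fun x => by
    have := congrArg (fun T : H →L[ℂ] H => T x) u.inv_mul
    rw [hu] at this
    simpa using this
  have hNn : ∀ x, ‖N x‖ ≤ 2 * ‖x‖ := fun x => by
    have h1 : ‖N x‖ ≤ ‖x‖ + ‖W 1 (N x)‖ := by
      calc ‖N x‖ = ‖x + W 1 (N x)‖ := by rw [← sub_eq_iff_eq_add.1 (hN1 x)]
        _ ≤ _ := norm_add_le _ _
    have h2 := (W 1).le_of_opNorm_le hW1 (N x)
    linarith
  have hgen : ∀ x, Gen U (I (N x)) ((l : ℂ) • I (N x) - x) := by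
    intro x
    have h1 := gen_integral hW (N x) 1
    rw [← hI, hWgen] at h1
    convert h1 using 1
    rw [← neg_sub (N x), hN1]
    abel
  refine ⟨l, I.comp N, ⟨hgen, fun x y hxy => ?_⟩, ?_⟩
  · have h1 := (hgen ((l : ℂ) • x - y)).sub hxy
    set d := I (N ((l : ℂ) • x - y)) - x with hd
    -- A vector killed by the generator of `W` is fixed by `W 1`, hence zero.
    have h2 : Gen W d 0 := by
      rw [hWgen, zero_add]
      convert h1 using 1
      rw [hd, smul_sub]; abel
    have h3 := h2.integral_eq hW 1
    simp only [map_zero, intervalIntegral.integral_zero] at h3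
    have h4 : d = 0 := by
      rw [← hN2 d, ← neg_sub, ← h3]; simp
    exact sub_eq_zero.1 h4
  · refine ContinuousLinearMap.opNorm_le_bound _ hε.le fun x => ?_
    calc ‖I (N x)‖ ≤ M / l * ‖N x‖ := hIn _
      _ ≤ M / l * (2 * ‖x‖) := by gcongr; exact hNn x
      _ = (2 * M / l) * ‖x‖ := by ring
      _ ≤ ε * ‖x‖ := by
          gcongr
          rw [div_le_iff₀ hl]
          rw [div_le_iff₀ hε] at hl2
          linarith

end Resolvent

/-! ### Exponential bounds -/

section Growth

variable {H : Type*} [NormedAddCommGroup H] [NormedSpace ℂ H] {U : ℝ → H →L[ℂ] H}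

theorem IsC0Group.apply_nat_mul (hU : IsC0Group U) (n : ℕ) (s : ℝ) : U (n * s) = U s ^ n := by
  induction n with
  | zero => simp [hU.map_zero]; rfl
  | succ n ih => rw [Nat.cast_succ, add_mul, one_mul, hU.map_add, ih, pow_succ]; rfl

/-- Strongly continuous groups are exponentially bounded. -/
theorem IsC0Group.exists_growth_bound [CompleteSpace H] (hU : IsC0Group U) :
    ∃ M w : ℝ, 1 ≤ M ∧ 0 ≤ w ∧ ∀ t, ‖U t‖ ≤ M * Real.exp (w * |t|) := by
  obtain ⟨M, hM1, hM⟩ := exists_norm_le_of_stronglyContinuous hU.strongly_continuous 1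
  refine ⟨M, Real.log M, hM1, Real.log_nonneg hM1, fun t => ?_⟩
  -- Splitting `t` into `n` equal steps of length at most `1` costs a factor `M` per step. The `+ 1`
  -- keeps `n` positive.
  set n := ⌊|t|⌋₊ + 1 with hn
  have hn0 : (0 : ℝ) < n := by positivity
  have hn1 : |t| ≤ n := by rw [hn]; push_cast; exact (Nat.lt_floor_add_one _).le
  have hn2 : (n : ℝ) ≤ |t| + 1 := by
    rw [hn]; push_cast; linarith [Nat.floor_le (abs_nonneg t)]
  have h1 : U t = U (t / n) ^ n := by rw [← hU.apply_nat_mul, mul_div_cancel₀ _ hn0.ne']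
  have h2 : ‖U (t / n)‖ ≤ M := hM _ (by
    rw [abs_div, abs_of_pos hn0]; exact div_le_one_of_le₀ hn1 hn0.le)
  calc ‖U t‖ ≤ ‖U (t / n)‖ ^ n := by rw [h1]; exact norm_pow_le' _ (Nat.succ_pos _)
    _ ≤ M ^ n := by gcongr
    _ = M ^ (n : ℝ) := (Real.rpow_natCast _ _).symm
    _ ≤ M ^ (|t| + 1) := Real.rpow_le_rpow_of_exponent_le hM1 hn2
    _ = M * Real.exp (Real.log M * |t|) := by
      rw [Real.rpow_add (by linarith), Real.rpow_one, Real.rpow_def_of_pos (by linarith), mul_comm]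

/-- The gain of the factor `1 / c` by integration is what makes the integral operator below a
contraction in an exponentially weighted norm. -/
theorem norm_integral_le_of_norm_le_exp {V : Type*} [NormedAddCommGroup V] [NormedSpace ℝ V]
    {f : ℝ → V} {C c t : ℝ} (hc : 0 < c) (hC : 0 ≤ C)
    (h : ∀ s ∈ Set.uIcc 0 t, ‖f s‖ ≤ C * Real.exp (c * |s|)) :
    ‖∫ s in (0 : ℝ)..t, f s‖ ≤ C / c * Real.exp (c * |t|) := by
  have key : ∀ (g : ℝ → V) (r : ℝ), 0 ≤ r →
      (∀ s ∈ Set.Ioc 0 r, ‖g s‖ ≤ C * Real.exp (c * s)) →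
      ‖∫ s in (0 : ℝ)..r, g s‖ ≤ C / c * Real.exp (c * r) := by
    intro g r hr hg
    have hder : ∀ s : ℝ, HasDerivAt (fun s => C / c * Real.exp (c * s))
        (C * Real.exp (c * s)) s := by
      intro s
      have h1 : HasDerivAt (fun s : ℝ => Real.exp (c * s)) (Real.exp (c * s) * c) s := by
        simpa using ((hasDerivAt_id s).const_mul c).exp
      refine (h1.const_mul (C / c)).congr_deriv ?_
      field_simp
    have hcont : Continuous fun s : ℝ => C * Real.exp (c * s) := by fun_prop
    calc ‖∫ s in (0 : ℝ)..r, g s‖ ≤ ∫ s in (0 : ℝ)..r, C * Real.exp (c * s) :=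
          intervalIntegral.norm_integral_le_of_norm_le hr (Eventually.of_forall hg)
            (hcont.intervalIntegrable _ _)
      _ = C / c * Real.exp (c * r) - C / c * Real.exp (c * 0) :=
          intervalIntegral.integral_eq_sub_of_hasDerivAt (fun s _ => hder s)
            (hcont.intervalIntegrable _ _)
      _ ≤ _ := by
          have : 0 ≤ C / c := by positivity
          simpa using this
  rcases le_total 0 t with ht | ht
  · rw [abs_of_nonneg ht]
    refine key f t ht fun s hs => ?_
    have := h s (by rw [Set.uIcc_of_le ht]; exact Set.Ioc_subset_Icc_self hs)
    rwa [abs_of_pos hs.1] at this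
  · have h1 : ∫ s in (0 : ℝ)..t, f s = -∫ s in (0 : ℝ)..(-t), f (-s) := by
      rw [intervalIntegral.integral_comp_neg, intervalIntegral.integral_symm]; simp
    rw [h1, norm_neg, abs_of_nonpos ht]
    refine key _ _ (neg_nonneg.2 ht) fun s hs => ?_
    have := h (-s) (by rw [Set.uIcc_of_ge ht]; exact ⟨by linarith [hs.2], by linarith [hs.1]⟩)
    rwa [abs_neg, abs_of_pos hs.1] at this

end Growth

/-! ### Bounded perturbations -/

section BoundedPerturbation

variable {H : Type*} [NormedAddCommGroup H] [NormedSpace ℂ H] [CompleteSpace H]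
  {U : ℝ → H →L[ℂ] H}

/-- Solvability of the variation of constants equation. -/
theorem exists_variation_of_constants (hU : IsC0Group U) (S : H →L[ℂ] H) :
    ∃ V : ℝ → H →L[ℂ] H, (∀ x, Continuous fun t => V t x) ∧
      ∀ t x, V t x = U t (x + ∫ s in (0 : ℝ)..t, U (-s) (S (V s x))) := by
  obtain ⟨M, w, hM1, hw, hM⟩ := hU.exists_growth_bound
  -- With the weight `exp (-(w + c) |t|)` the integral operator has norm at most `M ‖S‖ / c`, and
  -- this `c` makes that at most `1 / 2` on the whole line.
  set c : ℝ := 2 * (M * ‖S‖) + 1 with hc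
  have hMS : 0 ≤ M * ‖S‖ := by positivity
  have hc0 : 0 < c := by positivity
  set k : ℝ := w + c with hk
  set e : ℝ → ℂ := fun t => ((Real.exp (k * |t|) : ℝ) : ℂ) with he
  set e' : ℝ → ℂ := fun t => ((Real.exp (-(k * |t|)) : ℝ) : ℂ) with he'
  have hec : Continuous e := by rw [he]; fun_prop
  have hec' : Continuous e' := by rw [he']; fun_prop
  have hn : ∀ t, ‖e t‖ = Real.exp (k * |t|) := fun t => by
    rw [he, Complex.norm_real, Real.norm_of_nonneg (Real.exp_pos _).le]
  have hn' : ∀ t, ‖e' t‖ = Real.exp (-(k * |t|)) := fun t => by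
    rw [he', Complex.norm_real, Real.norm_of_nonneg (Real.exp_pos _).le]
  have hee' : ∀ t, e t * e' t = 1 := fun t => by
    rw [he, he', ← Complex.ofReal_mul, ← Real.exp_add]; simp
  -- the integrand and its estimate
  have hfc : ∀ b : BoundedContinuousFunction ℝ H, Continuous fun s => U (-s) (S (e s • b s)) :=
    fun b => continuous_apply_of_stronglyContinuous hU.strongly_continuous continuous_neg
      (S.continuous.comp (hec.smul b.continuous))
  have hPc : ∀ b : BoundedContinuousFunction ℝ H, Continuous fun t : ℝ =>
      e' t • U t (∫ s in (0 : ℝ)..t, U (-s) (S (e s • b s))) := fun b =>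
    hec'.smul (continuous_apply_of_stronglyContinuous hU.strongly_continuous continuous_id
      (intervalIntegral.continuous_primitive (fun _ _ => (hfc b).intervalIntegrable _ _) 0))
  have hPb : ∀ (b : BoundedContinuousFunction ℝ H) (t : ℝ),
      ‖e' t • U t (∫ s in (0 : ℝ)..t, U (-s) (S (e s • b s)))‖ ≤ 1 / 2 * ‖b‖ := by
    intro b t
    have h1 : U t (∫ s in (0 : ℝ)..t, U (-s) (S (e s • b s)))
        = ∫ s in (0 : ℝ)..t, U (t - s) (S (e s • b s)) := by
      rw [← ContinuousLinearMap.intervalIntegral_comp_comm _ ((hfc b).intervalIntegrable _ _)]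
      simp_rw [← hU.apply_add, ← sub_eq_add_neg]
    have h2 : ‖∫ s in (0 : ℝ)..t, U (t - s) (S (e s • b s))‖
        ≤ (M * ‖S‖ * ‖b‖ * Real.exp (w * |t|)) / c * Real.exp (c * |t|) := by
      refine norm_integral_le_of_norm_le_exp hc0 (by positivity) fun s hs => ?_
      have hts : |t - s| = |t| - |s| := by
        rcases Set.mem_uIcc.1 hs with h | h
        · rw [abs_of_nonneg h.1, abs_of_nonneg (h.1.trans h.2), abs_of_nonneg (by linarith)]
        · rw [abs_of_nonpos h.2, abs_of_nonpos (h.1.trans h.2), abs_of_nonpos (by linarith)]; ring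
      calc ‖U (t - s) (S (e s • b s))‖
          ≤ (M * Real.exp (w * |t - s|)) * (‖S‖ * (Real.exp (k * |s|) * ‖b‖)) := by
            refine (U (t - s)).le_of_opNorm_le_of_le (hM _) (S.le_opNorm_of_le ?_)
            rw [norm_smul, hn]
            gcongr
            exact b.norm_coe_le_norm s
        _ = M * ‖S‖ * ‖b‖ * (Real.exp (w * |t - s|) * Real.exp (k * |s|)) := by ring
        _ = M * ‖S‖ * ‖b‖ * (Real.exp (w * |t|) * Real.exp (c * |s|)) := by
            rw [← Real.exp_add, ← Real.exp_add, hts, hk]; ring_nf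
        _ = _ := by ring
    rw [norm_smul, hn', h1]
    calc Real.exp (-(k * |t|)) * ‖∫ s in (0 : ℝ)..t, U (t - s) (S (e s • b s))‖
        ≤ Real.exp (-(k * |t|)) *
          ((M * ‖S‖ * ‖b‖ * Real.exp (w * |t|)) / c * Real.exp (c * |t|)) := by gcongr
      _ = M * ‖S‖ / c * ‖b‖ *
          (Real.exp (-(k * |t|)) * (Real.exp (w * |t|) * Real.exp (c * |t|))) := by ring
      _ = M * ‖S‖ / c * ‖b‖ := by
          rw [← Real.exp_add, ← Real.exp_add, hk]; ring_nf; simp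
      _ ≤ 1 / 2 * ‖b‖ := by
          refine mul_le_mul_of_nonneg_right ?_ (norm_nonneg _)
          rw [div_le_iff₀ hc0, hc]; linarith
  -- The unknown is the weighted orbit `b t = exp (-k |t|) V t x`, which satisfies `b = J x + P b`
  -- and is found by inverting `1 - P`.
  obtain ⟨P, hP, hPn⟩ : ∃ P : BoundedContinuousFunction ℝ H →L[ℂ] BoundedContinuousFunction ℝ H,
      (∀ b t, P b t = e' t • U t (∫ s in (0 : ℝ)..t, U (-s) (S (e s • b s)))) ∧ ‖P‖ ≤ 1 / 2 := by
    refine ⟨LinearMap.mkContinuous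
      { toFun := fun b => BoundedContinuousFunction.ofNormedAddCommGroup _ (hPc b) (1 / 2 * ‖b‖) (hPb b)
        map_add' := fun b₁ b₂ => ?_
        map_smul' := fun a b => ?_ } (1 / 2) fun b => ?_, fun b t => rfl,
        LinearMap.mkContinuous_norm_le _ (by norm_num) _⟩
    · ext t
      simp only [BoundedContinuousFunction.coe_ofNormedAddCommGroup,
        BoundedContinuousFunction.add_apply, smul_add, map_add]
      rw [intervalIntegral.integral_add ((hfc b₁).intervalIntegrable _ _)
        ((hfc b₂).intervalIntegrable _ _), map_add, smul_add]
    · ext t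
      simp only [BoundedContinuousFunction.coe_ofNormedAddCommGroup,
        BoundedContinuousFunction.coe_smul, RingHom.id_apply, map_smul]
      rw [intervalIntegral.integral_congr (g := fun s => a • U (-s) (S (e s • b s)))
        (fun s _ => by simp only [smul_comm (e s) a, map_smul]),
        intervalIntegral.integral_smul, map_smul, smul_comm]
      simp only [map_smul]
    · exact BoundedContinuousFunction.norm_ofNormedAddCommGroup_le _ (by positivity) (hPb b)
  have hJb : ∀ x t, ‖e' t • U t x‖ ≤ M * ‖x‖ := by
    intro x t
    rw [norm_smul, hn']
    calc Real.exp (-(k * |t|)) * ‖U t x‖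
        ≤ Real.exp (-(k * |t|)) * (M * Real.exp (w * |t|) * ‖x‖) := by
          gcongr; exact (U t).le_of_opNorm_le (hM t) x
      _ = M * ‖x‖ * Real.exp (-(c * |t|)) := by
          rw [show -(c * |t|) = -(k * |t|) + w * |t| by rw [hk]; ring, Real.exp_add]; ring
      _ ≤ M * ‖x‖ * 1 := by
          gcongr
          exact Real.exp_le_one_iff.2 (neg_nonpos.2 (by positivity))
      _ = _ := mul_one _
  obtain ⟨J, hJ⟩ : ∃ J : H →L[ℂ] BoundedContinuousFunction ℝ H, ∀ x t, J x t = e' t • U t x := by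
    refine ⟨LinearMap.mkContinuous
      { toFun := fun x => BoundedContinuousFunction.ofNormedAddCommGroup _
          (hec'.smul (hU.strongly_continuous x)) (M * ‖x‖) (hJb x)
        map_add' := fun x y => ?_
        map_smul' := fun a x => ?_ } M fun x => ?_, fun x t => rfl⟩
    · ext t; simp
    · ext t
      change e' t • U t (a • x) = a • e' t • U t x
      rw [map_smul, smul_comm]
    · exact BoundedContinuousFunction.norm_ofNormedAddCommGroup_le _ (by positivity) (hJb x)
  obtain ⟨u, hu⟩ := isUnit_one_sub_of_norm_lt_one (x := P) (by linarith)
  set N : BoundedContinuousFunction ℝ H →L[ℂ] BoundedContinuousFunction ℝ H := ↑u⁻¹ with hN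
  have hN1 : ∀ b, N b = b + P (N b) := fun b => by
    have := congrArg (fun T : BoundedContinuousFunction ℝ H →L[ℂ] _ => T b) u.mul_inv
    rw [hu] at this
    exact sub_eq_iff_eq_add.1 (by simpa using this)
  refine ⟨fun t => e t • (BoundedContinuousFunction.evalCLM ℂ t).comp (N.comp J), fun x => ?_,
    fun t x => ?_⟩
  · exact hec.smul (N (J x)).continuous
  · change e t • N (J x) t = U t (x + ∫ s in (0 : ℝ)..t, U (-s) (S (e s • N (J x) s)))
    conv_lhs => rw [hN1]
    rw [BoundedContinuousFunction.add_apply, hJ, hP, ← smul_add, smul_smul, hee', one_smul,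
      map_add]

/-- Uniqueness for the variation of constants equation. -/
theorem variation_of_constants_unique (hU : IsC0Group U) (S : H →L[ℂ] H) {v₁ v₂ : ℝ → H} {x : H}
    (hc₁ : Continuous v₁) (hc₂ : Continuous v₂)
    (h₁ : ∀ t, v₁ t = U t (x + ∫ s in (0 : ℝ)..t, U (-s) (S (v₁ s))))
    (h₂ : ∀ t, v₂ t = U t (x + ∫ s in (0 : ℝ)..t, U (-s) (S (v₂ s)))) (t : ℝ) :
    v₁ t = v₂ t := by
  -- Pulled back by `U (-t)`, the equation becomes an ordinary differential equation whose
  -- right-hand side is Lipschitz, with no trace of the unbounded generator.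
  have key : ∀ v : ℝ → H, Continuous v →
      (∀ t, v t = U t (x + ∫ s in (0 : ℝ)..t, U (-s) (S (v s)))) →
      ∀ t, HasDerivAt (fun t => U (-t) (v t)) (U (-t) (S (U t (U (-t) (v t))))) t := by
    intro v hc hv t
    have hfc : Continuous fun s => U (-s) (S (v s)) :=
      continuous_apply_of_stronglyContinuous hU.strongly_continuous continuous_neg
        (S.continuous.comp hc)
    have hd : HasDerivAt (fun h => ∫ s in (0 : ℝ)..h, U (-s) (S (v s))) (U (-t) (S (v t))) t :=
      intervalIntegral.integral_hasDerivAt_right (hfc.intervalIntegrable _ _)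
        (hfc.stronglyMeasurableAtFilter _ _) hfc.continuousAt
    rw [hU.apply_apply_neg]
    refine (hd.const_add x).congr_of_eventuallyEq (Eventually.of_forall fun s => ?_)
    change U (-s) (v s) = _
    rw [hv s, hU.apply_neg_apply]
  obtain ⟨M, hM1, hM⟩ := exists_norm_le_of_stronglyContinuous hU.strongly_continuous (|t| + 1)
  have hM0 : 0 ≤ M := by linarith
  have hmem : ∀ s ∈ Set.Ioo (-(|t| + 1)) (|t| + 1), ‖U s‖ ≤ M ∧ ‖U (-s)‖ ≤ M := fun s hs => by
    have : |s| ≤ |t| + 1 := abs_le.2 ⟨hs.1.le, hs.2.le⟩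
    exact ⟨hM _ this, hM _ (by rwa [abs_neg])⟩
  have hlip : ∀ s ∈ Set.Ioo (-(|t| + 1)) (|t| + 1),
      LipschitzOnWith (M * (‖S‖ * M)).toNNReal (fun y => U (-s) (S (U s y))) Set.univ := by
    intro s hs
    obtain ⟨h1, h2⟩ := hmem s hs
    refine (LipschitzWith.of_dist_le_mul fun y z => ?_).lipschitzOnWith
    rw [Real.coe_toNNReal _ (by positivity), dist_eq_norm, dist_eq_norm, ← map_sub, ← map_sub,
      ← map_sub, mul_assoc, mul_assoc]
    exact (U (-s)).le_of_opNorm_le_of_le h2 (S.le_opNorm_of_le ((U s).le_of_opNorm_le h1 _))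
  have hpos : 0 < |t| + 1 := by positivity
  have := ODE_solution_unique_of_mem_Ioo (t₀ := 0) hlip ⟨by linarith, hpos⟩
    (fun s _ => ⟨key v₁ hc₁ h₁ s, Set.mem_univ _⟩) (fun s _ => ⟨key v₂ hc₂ h₂ s, Set.mem_univ _⟩)
    (by simp only [neg_zero]; rw [h₁ 0, h₂ 0]; simp)
    (show t ∈ _ from ⟨by linarith [neg_abs_le t], by linarith [le_abs_self t]⟩)
  have h3 : U t (U (-t) (v₁ t)) = U t (U (-t) (v₂ t)) := congrArg _ this
  rwa [hU.apply_apply_neg, hU.apply_apply_neg] at h3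

/-- Bounded perturbations of group generators generate groups. -/
theorem exists_bounded_perturbation (hU : IsC0Group U) (S : H →L[ℂ] H) :
    ∃ V : ℝ → H →L[ℂ] H, IsC0Group V ∧ ∀ x y, Gen V x y ↔ Gen U x (y - S x) := by
  obtain ⟨V, hVc, hV⟩ := exists_variation_of_constants hU S
  have hfc : ∀ x, Continuous fun s => U (-s) (S (V s x)) := fun x =>
    continuous_apply_of_stronglyContinuous hU.strongly_continuous continuous_neg
      (S.continuous.comp (hVc x))
  have hV0 : ∀ x, V 0 x = x := fun x => by rw [hV]; simp [hU.apply_zero]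
  refine ⟨V, ⟨?_, fun t s => ?_, hVc⟩, fun x y => ?_⟩
  · ext x; exact hV0 x
  · ext x
    change V (t + s) x = V t (V s x)
    -- Both sides of the group law, as functions of `t`, solve the equation with initial value `V s
    -- x`.
    refine variation_of_constants_unique hU S (x := V s x)
      ((hVc x).comp (continuous_add_const s)) (hVc (V s x)) (fun r => ?_) (fun r => hV r _) t
    change V (r + s) x = U r (V s x + ∫ q in (0 : ℝ)..r, U (-q) (S (V (q + s) x)))
    have h1 : ∫ q in (0 : ℝ)..r, U (-q) (S (V (q + s) x))
        = U s (∫ q in s..(r + s), U (-q) (S (V q x))) := by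
      rw [← ContinuousLinearMap.intervalIntegral_comp_comm _ ((hfc x).intervalIntegrable _ _)]
      simp_rw [← hU.apply_add]
      have := intervalIntegral.integral_comp_add_right (a := 0) (b := r)
        (fun q => U (s + -q) (S (V q x))) s
      rw [zero_add] at this
      rw [← this]
      simp
    rw [h1, hV (r + s), hV s, ← map_add, ← hU.apply_add, add_assoc,
      intervalIntegral.integral_add_adjacent_intervals ((hfc x).intervalIntegrable _ _)
        ((hfc x).intervalIntegrable _ _)]
  · have hd : HasDerivAt (fun h => ∫ s in (0 : ℝ)..h, U (-s) (S (V s x))) (S x) 0 := by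
      have := intervalIntegral.integral_hasDerivAt_right ((hfc x).intervalIntegrable 0 0)
        ((hfc x).stronglyMeasurableAtFilter _ _) (hfc x).continuousAt
      simpa [hU.apply_zero, hV0] using this
    -- This term is the difference `V t x - U t x`, so the derivatives of the two orbits at `0`
    -- differ by exactly `S x`.
    have h2 : HasDerivAt (fun t => U t (∫ s in (0 : ℝ)..t, U (-s) (S (V s x)))) (S x) 0 := by
      have := hasDerivAt_apply_of_stronglyContinuous hU.strongly_continuous hd (z := 0)
        (by simpa using hasDerivAt_const (0 : ℝ) (0 : H))
      simpa [hU.apply_zero] using this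
    have h3 : ∀ t, V t x = U t x + U t (∫ s in (0 : ℝ)..t, U (-s) (S (V s x))) := fun t => by
      rw [← map_add]; exact hV t x
    constructor
    · intro h
      refine (HasDerivAt.sub h h2).congr_of_eventuallyEq (Eventually.of_forall fun t => ?_)
      simp [h3 t]
    · intro h
      have h4 := HasDerivAt.add h h2
      rw [sub_add_cancel] at h4
      exact h4.congr_of_eventuallyEq (Eventually.of_forall h3)

end BoundedPerturbation

/-! ### Perturbations bounded for the graph norm -/

section RelativePerturbation

variable {H : Type*} [NormedAddCommGroup H] [NormedSpace ℂ H]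
  {U : ℝ → H →L[ℂ] H}

/-- The inverse is `1 + b (1 - a b)⁻¹ a`. Smallness is thus only needed for one of the two products.
-/
theorem isUnit_one_sub_mul_swap {A : Type*} [Ring A] {a b : A} (h : IsUnit (1 - a * b)) :
    IsUnit (1 - b * a) := by
  obtain ⟨u, hu⟩ := h
  refine ⟨⟨1 - b * a, 1 + b * ↑u⁻¹ * a, ?_, ?_⟩, rfl⟩
  · calc (1 - b * a) * (1 + b * ↑u⁻¹ * a) = 1 - b * a + b * ((1 - a * b) * ↑u⁻¹) * a := by
          noncomm_ring
      _ = 1 := by rw [← hu, u.mul_inv]; noncomm_ring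
  · calc (1 + b * ↑u⁻¹ * a) * (1 - b * a) = 1 - b * a + b * (↑u⁻¹ * (1 - a * b)) * a := by
          noncomm_ring
      _ = 1 := by rw [← hu, u.inv_mul]; noncomm_ring

theorem IsC0Group.isC0Semigroup {U : ℝ → H →L[ℂ] H} (hU : IsC0Group U) : IsC0Semigroup U where
  map_zero := hU.map_zero
  map_add s t _ _ := hU.map_add s t
  strongly_continuous x := (hU.strongly_continuous x).continuousOn

/-- Conjugation of a group by an isomorphism. -/
theorem IsC0Group.conj {H' : Type*} [NormedAddCommGroup H'] [NormedSpace ℂ H'] (hU : IsC0Group U)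
    (M : H ≃L[ℂ] H') :
    IsC0Group (fun t => (M : H →L[ℂ] H').comp ((U t).comp (M.symm : H' →L[ℂ] H))) ∧
      ∀ x y, Gen (fun t => (M : H →L[ℂ] H').comp ((U t).comp (M.symm : H' →L[ℂ] H))) x y ↔
        Gen U (M.symm x) (M.symm y) := by
  refine ⟨⟨?_, fun s t => ?_, fun x => M.continuous.comp (hU.strongly_continuous _)⟩,
    fun x y => ⟨fun h => ?_, fun h => ?_⟩⟩
  · ext x; simp [hU.map_zero]
  · ext x; simp [hU.map_add]
  · have := ((M.symm : H' →L[ℂ] H).restrictScalars ℝ).hasFDerivAt.comp_hasDerivAt 0 h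
    simpa [Gen, Function.comp_def] using this
  · have := ((M : H →L[ℂ] H').restrictScalars ℝ).hasFDerivAt.comp_hasDerivAt 0 h
    simpa [Gen, Function.comp_def] using this

/-- Restriction of a group to a complemented subspace invariant under the generator. -/
theorem IsC0Group.exists_restrict [CompleteSpace H] {H' : Type*} [NormedAddCommGroup H']
    [NormedSpace ℂ H'] (hU : IsC0Group U) (p : H →L[ℂ] H') (q : H' →L[ℂ] H)
    (hpq : ∀ x, p (q x) = x) (hinv : ∀ x y, Gen U x y → Gen U (q (p x)) (q (p y))) :
    ∃ V : ℝ → H' →L[ℂ] H', IsC0Group V ∧ ∀ x y, Gen V x y ↔ Gen U (q x) (q y) := by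
  -- The projection `q ∘ p` respects the generator, hence commutes with the group.
  have hcomm : ∀ t x, q (p (U t x)) = U t (q (p x)) :=
    intertwine hU hU (q.comp p) (dense_gen_domain hU) hinv
  refine ⟨fun t => p.comp ((U t).comp q), ⟨?_, fun s t => ?_, fun x =>
    p.continuous.comp (hU.strongly_continuous _)⟩, fun x y => ⟨fun h => ?_, fun h => ?_⟩⟩
  · ext x; simp [hU.map_zero, hpq]
  · ext x
    change p (U (s + t) (q x)) = p (U s (q (p (U t (q x)))))
    rw [hcomm, hpq, hU.apply_add]
  · have h1 := (q.restrictScalars ℝ).hasFDerivAt.comp_hasDerivAt 0 h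
    refine h1.congr_of_eventuallyEq (Eventually.of_forall fun t => ?_)
    change U t (q x) = q (p (U t (q x)))
    rw [hcomm, hpq]
  · have h1 := (p.restrictScalars ℝ).hasFDerivAt.comp_hasDerivAt 0 h
    have h2 : (p.restrictScalars ℝ) (q y) = y := hpq y
    rw [h2] at h1
    exact h1

variable [CompleteSpace H]

/-- Perturbations of a group generator that are bounded on its domain, with respect to the graph
norm, generate groups. -/
theorem exists_relative_perturbation (hU : IsC0Group U) (G : H →ₗ.[ℂ] H)
    (hG : ∀ x y, (x, y) ∈ G.graph ↔ Gen U x y) (Q : G.domain →ₗ[ℂ] G.domain) (c : ℝ)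
    (hQ : ∀ x, ‖(Q x : H)‖ + ‖G (Q x)‖ ≤ c * (‖(x : H)‖ + ‖G x‖)) :
    ∃ V : ℝ → H →L[ℂ] H, IsC0Group V ∧
      ∀ x y, Gen V x y ↔ ∃ h : x ∈ G.domain, G ⟨x, h⟩ + (Q ⟨x, h⟩ : H) = y := by
  have hGg : ∀ x : G.domain, Gen U x (G x) := fun x => (hG _ _).1 (G.mem_graph x)
  have hGd : ∀ {x y}, Gen U x y → ∃ h : x ∈ G.domain, G ⟨x, h⟩ = y := fun {x y} h => by
    obtain ⟨z, hz1, hz2⟩ := (LinearPMap.mem_graph_iff G).1 ((hG _ _).2 h)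
    obtain ⟨z, hz⟩ := z
    simp only at hz1 hz2
    subst hz1
    exact ⟨hz, hz2⟩
  -- `R` is bounded into the graph norm, so both `Q R` and `S = (l - G) Q R` are bounded on `H`.
  have hres : ∀ (l : ℝ) (R : H →L[ℂ] H), IsResolvent U l R →
      ∃ (QR S : H →L[ℂ] H) (hR : ∀ x, R x ∈ G.domain), ∀ x, QR x = Q ⟨R x, hR x⟩ ∧
        S x = (l : ℂ) • QR x - G (Q ⟨R x, hR x⟩) := by
    intro l R hR
    have hRd : ∀ x, R x ∈ G.domain := fun x => (hGd (hR.gen x)).1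
    have hRG : ∀ x, G ⟨R x, hRd x⟩ = (l : ℂ) • R x - x := fun x => (hGd (hR.gen x)).2
    let Rd : H →ₗ[ℂ] G.domain := (R : H →ₗ[ℂ] H).codRestrict G.domain hRd
    have hb : ∀ x, ‖(Q (Rd x) : H)‖ + ‖G (Q (Rd x))‖ ≤
        |c| * (‖R‖ + (‖(l : ℂ)‖ * ‖R‖ + 1)) * ‖x‖ := by
      intro x
      refine (hQ _).trans ?_
      have h1 : G (Rd x) = (l : ℂ) • R x - x := hRG x
      rw [h1, mul_assoc]
      have h2 : ‖((Rd x : G.domain) : H)‖ ≤ ‖R‖ * ‖x‖ := R.le_opNorm x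
      have h3 : ‖(l : ℂ) • R x - x‖ ≤ ‖(l : ℂ)‖ * (‖R‖ * ‖x‖) + ‖x‖ := by
        refine (norm_sub_le _ _).trans ?_
        rw [norm_smul]
        gcongr
        exact R.le_opNorm x
      calc c * (‖((Rd x : G.domain) : H)‖ + ‖(l : ℂ) • R x - x‖)
          ≤ |c| * (‖((Rd x : G.domain) : H)‖ + ‖(l : ℂ) • R x - x‖) := by
            gcongr; exact le_abs_self c
        _ ≤ |c| * (‖R‖ * ‖x‖ + (‖(l : ℂ)‖ * (‖R‖ * ‖x‖) + ‖x‖)) := by gcongr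
        _ = _ := by ring
    let QR : H →L[ℂ] H := LinearMap.mkContinuous
      (G.domain.subtype.comp (Q.comp Rd)) _ fun x =>
        (le_add_of_nonneg_right (norm_nonneg _)).trans (hb x)
    let GQR : H →L[ℂ] H := LinearMap.mkContinuous (G.toFun.comp (Q.comp Rd)) _ fun x =>
      (le_add_of_nonneg_left (norm_nonneg _)).trans (hb x)
    exact ⟨QR, (l : ℂ) • QR - GQR, hRd, fun x => ⟨rfl, rfl⟩⟩
  obtain ⟨l₀, R₀, hR₀, -⟩ := exists_isResolvent hU one_pos
  obtain ⟨QR₀, S₀, hd₀, h₀⟩ := hres l₀ R₀ hR₀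
  -- `‖Q R‖` itself need not become small for large `l`. With a reference point `l₀` fixed, `R` is
  -- chosen so that `‖R S₀‖ < 1`.
  obtain ⟨l, R, hR, hRn⟩ := exists_isResolvent hU
    (show (0 : ℝ) < 1 / (2 * (‖S₀‖ + 1)) by positivity)
  obtain ⟨QR, S, hd, h⟩ := hres l R hR
  -- `b = (l₀ - G) R`, so that `R = R₀ b`, `Q R = (Q R₀) b` and `b (Q R₀) = R S₀`. Swapping the
  -- factors makes `1 - Q R` invertible.
  set b : H →L[ℂ] H := 1 + ((l₀ : ℂ) - l) • R with hb
  have hRb : ∀ x, R₀ (b x) = R x := fun x => by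
    have := hR₀.left_inv _ _ (hR.gen x)
    rw [← this]
    congr 1
    simp [hb, sub_smul]
    abel
  have hQRb : QR = QR₀ * b := by
    ext x
    change QR x = QR₀ (b x)
    rw [(h x).1, (h₀ _).1]
    simp only [hRb]
  have hbQR : b * QR₀ = R * S₀ := by
    ext x
    change b (QR₀ x) = R (S₀ x)
    have h1 := hR.left_inv _ _ (hGg (Q ⟨R₀ x, hd₀ x⟩))
    rw [← (h₀ x).1] at h1
    rw [map_sub, map_smul, sub_eq_iff_eq_add] at h1
    rw [(h₀ x).2, map_sub, map_smul]
    have hbx : b (QR₀ x) = QR₀ x + ((l₀ : ℂ) - l) • R (QR₀ x) := rfl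
    rw [hbx, sub_smul, h1]
    abel
  have hunit : IsUnit (1 - QR) := by
    rw [hQRb]
    apply isUnit_one_sub_mul_swap
    rw [hbQR]
    apply isUnit_one_sub_of_norm_lt_one
    calc ‖R * S₀‖ ≤ ‖R‖ * ‖S₀‖ := norm_mul_le _ _
      _ ≤ 1 / (2 * (‖S₀‖ + 1)) * ‖S₀‖ := by gcongr
      _ < 1 := by
        rw [one_div, inv_mul_lt_iff₀ (by positivity)]
        linarith [norm_nonneg S₀]
  obtain ⟨u, hu⟩ := hunit
  obtain ⟨V, hV, hVgen⟩ := exists_bounded_perturbation hU S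
  -- For `M = 1 - Q R` one has `G + Q = M (G + S) M⁻¹`; domains agree because `Q R` maps into
  -- `D(G)`.
  let M : H ≃L[ℂ] H := ContinuousLinearEquiv.unitsEquiv ℂ H u
  obtain ⟨hMV, hMgen⟩ := hV.conj M
  refine ⟨_, hMV, fun x y => ?_⟩
  rw [hMgen, hVgen]
  have hM : ∀ z, M z = z - QR z := fun z => by
    change (u : H →L[ℂ] H) z = _
    rw [hu]; rfl
  obtain ⟨x', rfl⟩ := M.surjective x
  obtain ⟨y', rfl⟩ := M.surjective y
  rw [M.symm_apply_apply, M.symm_apply_apply]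
  -- the algebraic identity behind the similarity
  have hident : ∀ (z : G.domain), (z : H) = x' - QR x' →
      (G z + Q z : H) = M (G z + (l : ℂ) • QR x') := by
    intro z hz
    have h1 : QR ((l : ℂ) • (z : H) - G z) = Q z := by
      rw [(h _).1]
      congr 2
      exact Subtype.ext (hR.left_inv _ _ (hGg z))
    have h2 : QR (QR x') = QR x' - QR z := by
      rw [hz, map_sub]; abel
    rw [map_sub, map_smul, sub_eq_iff_eq_add] at h1
    rw [hM, map_add, map_smul, h2, smul_sub, h1]
    abel
  have hQRgen : Gen U (QR x') (G (Q ⟨R x', hd x'⟩)) := by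
    rw [(h x').1]; exact hGg _
  constructor
  · intro hg
    have h1 : Gen U (M x') (y' - (l : ℂ) • QR x') := by
      have := hg.sub hQRgen
      rw [hM]
      convert this using 1
      rw [(h x').2]; abel
    obtain ⟨hx, hxy⟩ := hGd h1
    refine ⟨hx, ?_⟩
    rw [hident ⟨_, hx⟩ (hM x'), hxy]
    simp
  · rintro ⟨hx, hxy⟩
    rw [hident ⟨_, hx⟩ (hM x')] at hxy
    rw [← M.injective hxy]
    have := (hGg ⟨_, hx⟩).add hQRgen
    simp only at this
    convert this using 1
    · rw [hM]; abel
    · rw [(h x').2]; abel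

end RelativePerturbation

/-! ### From semigroups to groups -/

section SemigroupToGroup

variable {H : Type*} [NormedAddCommGroup H] [NormedSpace ℂ H] [CompleteSpace H]

/-- The left difference quotient is `U (-t)` applied to the right one, so it has the same limit by
joint continuity. -/
theorem gen_iff_tendsto_right {U : ℝ → H →L[ℂ] H} (hU : IsC0Group U) (x y : H) :
    Gen U x y ↔ Tendsto (fun t : ℝ => t⁻¹ • (U t x - x)) (𝓝[>] 0) (𝓝 y) := by
  rw [Gen, hasDerivAt_iff_tendsto_slope_zero]
  simp only [zero_add, hU.apply_zero]
  refine ⟨fun h => h.mono_left (nhdsWithin_mono _ fun t ht => (Set.mem_Ioi.1 ht).ne'), fun h => ?_⟩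
  have hsplit : 𝓝[≠] (0 : ℝ) = 𝓝[<] 0 ⊔ 𝓝[>] 0 := by
    rw [← nhdsWithin_union, Set.Iio_union_Ioi]
  rw [hsplit, tendsto_sup]
  refine ⟨?_, h⟩
  have hneg : Tendsto (fun t : ℝ => -t) (𝓝[<] 0) (𝓝[>] 0) := by
    simpa using tendsto_neg_nhdsLT (a := (0 : ℝ))
  have h1 : Tendsto (fun t : ℝ => (-t)⁻¹ • (U (-t) x - x)) (𝓝[<] 0) (𝓝 y) := h.comp hneg
  have h2 := ((continuous_uncurry_of_stronglyContinuous hU.strongly_continuous).tendsto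
    ((0 : ℝ), y)).comp
      (((tendsto_id (α := ℝ) (x := 𝓝 0)).mono_left (nhdsWithin_le_nhds (s := Set.Iio 0))).prodMk_nhds h1)
  simp only [hU.apply_zero] at h2
  refine h2.congr fun t => ?_
  simp only [Function.comp, id]
  rw [← Complex.coe_smul, ← Complex.coe_smul, map_smul, map_sub, hU.apply_apply_neg]
  rw [← neg_sub (U t x) x, smul_neg]
  simp

/-- A semigroup whose generator is similar to its negative, by an involution, extends to a group. -/
theorem exists_group_of_semigroup {T : ℝ → H →L[ℂ] H} (hT : IsC0Semigroup T) {G : H →ₗ.[ℂ] H}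
    (hG : IsSemigroupGenerator T G) (J : H →L[ℂ] H) (hJ : ∀ x, J (J x) = x)
    (hJG : ∀ x y, (x, y) ∈ G.graph → (J x, -J y) ∈ G.graph) (hd : Dense (G.domain : Set H)) :
    ∃ U : ℝ → H →L[ℂ] H, IsC0Group U ∧ ∀ x y, (x, y) ∈ G.graph ↔ Gen U x y := by
  -- Values at negative times are unconstrained; freezing them at `T 0` gives a family strongly
  -- continuous on all of `ℝ`.
  set T' : ℝ → H →L[ℂ] H := fun t => T (max t 0) with hT'
  have hT'c : ∀ x, Continuous fun t => T' t x := fun x =>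
    (hT.strongly_continuous x).comp_continuous (continuous_id.max continuous_const)
      fun t => Set.mem_Ici.2 (le_max_right _ _)
  have hT'pos : ∀ {t}, 0 ≤ t → T' t = T t := fun {t} ht => by rw [hT']; simp [ht]
  have hTadd : ∀ {s t : ℝ}, 0 ≤ s → 0 ≤ t → ∀ x, T' (s + t) x = T' s (T' t x) :=
    fun {s t} hs ht x => by
      rw [hT'pos hs, hT'pos ht, hT'pos (add_nonneg hs ht), hT.map_add s t hs ht]; rfl
  have hT0 : ∀ x, T' 0 x = x := fun x => by rw [hT'pos le_rfl, hT.map_zero]; rfl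
  -- The conjugated semigroup has generator `-G` and will be the inverse of `T'`.
  set S' : ℝ → H →L[ℂ] H := fun t => J.comp ((T' t).comp J) with hS'
  have hSapp : ∀ t x, S' t x = J (T' t (J x)) := fun t x => rfl
  have hS'c : ∀ x, Continuous fun t => S' t x := fun x => J.continuous.comp (hT'c _)
  have hSadd : ∀ {s t : ℝ}, 0 ≤ s → 0 ≤ t → ∀ x, S' (s + t) x = S' s (S' t x) :=
    fun {s t} hs ht x => by simp only [hSapp, hTadd hs ht, hJ]
  have hS0 : ∀ x, S' 0 x = x := fun x => by rw [hSapp, hT0, hJ]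
  have hGT : ∀ x y, (x, y) ∈ G.graph ↔
      Tendsto (fun t : ℝ => t⁻¹ • (T' t x - x)) (𝓝[>] 0) (𝓝 y) := fun x y => by
    rw [hG]
    refine tendsto_congr' ?_
    filter_upwards [self_mem_nhdsWithin] with t ht
    rw [hT'pos (le_of_lt ht)]
  have hGTt : ∀ {x y}, (x, y) ∈ G.graph → ∀ t, 0 ≤ t → (T' t x, T' t y) ∈ G.graph := by
    intro x y hxy t ht
    rw [hGT] at hxy ⊢
    refine (((T' t).continuous.tendsto y).comp hxy).congr' ?_
    filter_upwards [self_mem_nhdsWithin] with s hs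
    rw [Function.comp, ← Complex.coe_smul, ← Complex.coe_smul, map_smul, map_sub,
      ← hTadd ht (le_of_lt hs), ← hTadd (le_of_lt hs) ht, add_comm]
  have hGS : ∀ {x y}, (x, y) ∈ G.graph →
      Tendsto (fun t : ℝ => t⁻¹ • (S' t x - x)) (𝓝[>] 0) (𝓝 (-y)) := by
    intro x y hxy
    have h1 := (J.continuous.tendsto _).comp ((hGT _ _).1 (hJG x y hxy))
    rw [map_neg, hJ] at h1
    refine h1.congr fun s => ?_
    rw [Function.comp, ← Complex.coe_smul, ← Complex.coe_smul, map_smul, map_sub, hJ, hSapp]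
  have hGSt : ∀ {x y}, (x, y) ∈ G.graph → ∀ t, 0 ≤ t → (S' t x, S' t y) ∈ G.graph := by
    intro x y hxy t ht
    have h1 := hJG _ _ (hGTt (hJG x y hxy) t ht)
    rw [map_neg, map_neg, neg_neg] at h1
    exact h1
  have hprod : ∀ {z y}, (z, y) ∈ G.graph →
      Tendsto (fun t : ℝ => t⁻¹ • (T' t (S' t z) - z)) (𝓝[>] 0) (𝓝 0) := by
    intro z y hzy
    have h1 := ((continuous_uncurry_of_stronglyContinuous hT'c).tendsto ((0 : ℝ), -y)).comp
      (((tendsto_id (α := ℝ) (x := 𝓝 0)).mono_left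
        (nhdsWithin_le_nhds (s := Set.Ioi 0))).prodMk_nhds (hGS hzy))
    have h2 := h1.add ((hGT _ _).1 hzy)
    simp only [hT0, neg_add_cancel] at h2
    refine h2.congr fun t => ?_
    simp only [Function.comp, id]
    rw [← Complex.coe_smul, ← Complex.coe_smul, ← Complex.coe_smul, map_smul, map_sub, ← smul_add]
    congr 1
    abel
  have hTS : ∀ t, 0 ≤ t → ∀ x, T' t (S' t x) = x := by
    intro t ht x
    refine hd.induction (P := fun x => T' t (S' t x) = x) ?_
      (isClosed_eq (by fun_prop) continuous_id) x
    intro x hx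
    obtain ⟨y, hxy⟩ := LinearPMap.mem_domain_iff.1 hx
    have hcont : Continuous fun t => T' t (S' t x) :=
      continuous_apply_of_stronglyContinuous hT'c continuous_id (hS'c x)
    -- On the domain, `T' s (S' s x)` has right derivative `0`, since `G` and `-G` cancel. Only
    -- right derivatives are available for semigroups.
    have h1 := constant_of_has_deriv_right_zero (a := 0) (b := t) hcont.continuousOn
      (fun s hs => ?_) t ⟨ht, le_rfl⟩
    · simpa [hT0, hS0] using h1
    · rw [← hasDerivWithinAt_Ioi_iff_Ici, hasDerivWithinAt_iff_tendsto_slope' (by simp : s ∉ Set.Ioi s)]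
      have hsub : Tendsto (fun r : ℝ => r - s) (𝓝[>] s) (𝓝[>] 0) := by
        refine tendsto_nhdsWithin_iff.2 ⟨?_, ?_⟩
        · have : Continuous fun r : ℝ => r - s := by fun_prop
          simpa using (this.tendsto s).mono_left (nhdsWithin_le_nhds (s := Set.Ioi s))
        · filter_upwards [self_mem_nhdsWithin] with r hr
          exact Set.mem_Ioi.2 (sub_pos.2 (Set.mem_Ioi.1 hr))
      have h2 := ((T' s).continuous.tendsto 0).comp ((hprod (hGSt hxy s hs.1)).comp hsub)
      rw [map_zero] at h2
      refine h2.congr' ?_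
      filter_upwards [self_mem_nhdsWithin] with r hr
      have hr0 : 0 ≤ r - s := sub_nonneg.2 (le_of_lt hr)
      simp only [Function.comp, slope, vsub_eq_sub]
      rw [← Complex.coe_smul, ← Complex.coe_smul, map_smul, map_sub, ← hTadd hs.1 hr0,
        ← hSadd hr0 hs.1]
      simp
  have hST : ∀ t, 0 ≤ t → ∀ x, S' t (T' t x) = x := by
    intro t ht x
    rw [hSapp]
    have h1 := hTS t ht (J x)
    rw [hSapp, hJ] at h1
    rw [h1, hJ]
  have hcomm : ∀ {a b : ℝ}, 0 ≤ a → 0 ≤ b → ∀ x, T' a (S' b x) = S' b (T' a x) := by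
    intro a b ha hb x
    rw [← hST b hb (T' a (S' b x)), ← hTadd hb ha, add_comm, hTadd ha hb, hTS b hb]
  have hdiff : ∀ {a b c : ℝ}, 0 ≤ a → 0 ≤ b → 0 ≤ c → ∀ x,
      T' (a + c) (S' (b + c) x) = T' a (S' b x) := by
    intro a b c ha hb hc x
    rw [hTadd ha hc, add_comm b, hSadd hc hb, hTS c hc]
  set U : ℝ → H →L[ℂ] H := fun t => (T' t).comp (S' (-t)) with hUdef
  have hmax : ∀ t, T' (max t 0) = T' t := fun t => by simp [hT']
  have hSmax : ∀ t, S' (max t 0) = S' t := fun t => by simp [hS', hmax]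
  have hUab : ∀ {a b : ℝ}, 0 ≤ a → 0 ≤ b → ∀ x, U (a - b) x = T' a (S' b x) := by
    intro a b ha hb x
    change T' (a - b) (S' (-(a - b)) x) = _
    -- The common part `min a b` of the two times cancels because `T'` and `S'` are inverse to each
    -- other.
    rw [← hmax (a - b), ← hSmax (-(a - b)), ← hdiff (le_max_right _ _) (le_max_right _ _)
      (le_min ha hb) x]
    congr 2
    · rcases le_total a b with h | h <;> simp [h]
    · rcases le_total a b with h | h <;> simp [h]
  have hU : IsC0Group U := by
    refine ⟨?_, fun s t => ?_, fun x => ?_⟩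
    · ext x
      simpa [hT0, hS0] using hUab (a := 0) (b := 0) le_rfl le_rfl x
    · ext x
      have h1 : ∀ s : ℝ, s = max s 0 - max (-s) 0 := fun s => by
        rcases le_total 0 s with h | h <;> simp [h]
      have ha := le_max_right s 0
      have hb := le_max_right (-s) 0
      have ha' := le_max_right t 0
      have hb' := le_max_right (-t) 0
      have h2 := hUab (add_nonneg ha ha') (add_nonneg hb' hb) x
      have h3 : max s 0 + max t 0 - (max (-t) 0 + max (-s) 0) = s + t := by
        linarith [h1 s, h1 t]
      rw [h3] at h2
      change U (s + t) x = U s (U t x)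
      rw [h2]
      conv_rhs => rw [h1 s, h1 t]
      rw [hUab ha hb, hUab ha' hb', hTadd ha ha', add_comm, hSadd hb hb', ← hcomm ha' hb]
    · exact continuous_apply_of_stronglyContinuous hT'c continuous_id
        ((hS'c x).comp continuous_neg)
  refine ⟨U, hU, fun x y => ?_⟩
  rw [hGT, gen_iff_tendsto_right hU]
  refine tendsto_congr' ?_
  filter_upwards [self_mem_nhdsWithin] with t ht
  have := hUab (le_of_lt ht) le_rfl x
  rw [sub_zero, hS0] at this
  rw [this]

end SemigroupToGroup

/-! ### Reduction groups and cosine functions -/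

section Reduction

variable {E F : Type*} [NormedAddCommGroup E] [NormedSpace ℂ E]
  [NormedAddCommGroup F] [NormedSpace ℂ F]

theorem mem_graph_iff_exists {V W : Type*} [AddCommGroup V] [Module ℂ V] [AddCommGroup W]
    [Module ℂ W] {K : V →ₗ.[ℂ] W} {x : V} {y : W} :
    (x, y) ∈ K.graph ↔ ∃ h : x ∈ K.domain, K ⟨x, h⟩ = y := by
  rw [LinearPMap.mem_graph_iff]
  constructor
  · rintro ⟨⟨z, hz⟩, h1, h2⟩
    simp only at h1 h2
    subst h1
    exact ⟨hz, h2⟩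
  · rintro ⟨h, h2⟩
    exact ⟨⟨x, h⟩, rfl, h2⟩

theorem mem_graph_reductionMatrix {K : E →ₗ.[ℂ] E} {i : F →L[ℂ] E} {hi : Function.Injective i}
    {f f' : F} {e e' : E} :
    ((f, e), (f', e')) ∈ (reductionMatrix K i hi).graph ↔ i f' = e ∧ (i f, e') ∈ K.graph := by
  rw [mem_graph_iff_exists, mem_graph_iff_exists]
  constructor
  · rintro ⟨⟨h1, h2⟩, h⟩
    obtain ⟨h3, h4⟩ := Prod.ext_iff.1 h
    refine ⟨?_, h1, h4⟩
    have h3' : (LinearEquiv.ofInjective (i : F →ₗ[ℂ] E) hi).symm ⟨e, h2⟩ = f' := h3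
    rw [LinearEquiv.symm_apply_eq] at h3'
    exact (congrArg Subtype.val h3').symm
  · rintro ⟨h1, h2, h3⟩
    refine ⟨⟨h2, ⟨f', h1⟩⟩, Prod.ext ?_ h3⟩
    change (LinearEquiv.ofInjective (i : F →ₗ[ℂ] E) hi).symm ⟨e, _⟩ = f'
    rw [LinearEquiv.symm_apply_eq]
    exact Subtype.ext h1.symm

/-- `U` is a strongly continuous group generated by the reduction matrix of `K`. -/
def IsReductionGroup (K : E →ₗ.[ℂ] E) (i : F →L[ℂ] E) (U : ℝ → (F × E) →L[ℂ] (F × E)) : Prop :=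
  IsC0Group U ∧ ∀ f e f' e', Gen U (f, e) (f', e') ↔ i f' = e ∧ (i f, e') ∈ K.graph

/-- The reflection `(f, e) ↦ (f, -e)`. -/
def reflection (F E : Type*) [NormedAddCommGroup E] [NormedSpace ℂ E]
    [NormedAddCommGroup F] [NormedSpace ℂ F] : (F × E) →L[ℂ] (F × E) :=
  (ContinuousLinearMap.id ℂ F).prodMap (-ContinuousLinearMap.id ℂ E)

theorem reflection_apply (p : F × E) : reflection F E p = (p.1, -p.2) := rfl

/-- A second order Taylor formula requiring `ψ` to be differentiable only at `0`: subtract `(t ^ 2 /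
2) • y` and apply the mean value inequality. -/
theorem tendsto_two_div_sq_smul {φ ψ : ℝ → E} {y : E} (hφ : ∀ t, HasDerivAt φ (ψ t) t)
    (hψ0 : ψ 0 = 0) (hψ : HasDerivAt ψ y 0) :
    Tendsto (fun t : ℝ => (2 / t ^ 2) • (φ t - φ 0)) (𝓝[≠] 0) (𝓝 y) := by
  rw [Metric.tendsto_nhds]
  intro ε hε
  have h1 := (hasDerivAt_iff_isLittleO.1 hψ).def (show (0 : ℝ) < ε / 4 by positivity)
  obtain ⟨δ, hδ, hδ'⟩ := Metric.eventually_nhds_iff.1 h1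
  filter_upwards [nhdsWithin_le_nhds (Metric.ball_mem_nhds (0 : ℝ) hδ), self_mem_nhdsWithin]
    with t ht ht0
  have ht1 : |t| < δ := by simpa using ht
  have ht0 : t ≠ 0 := ht0
  set g : ℝ → E := fun s => φ s - (s ^ 2 / 2) • y with hg
  have hgd : ∀ s, HasDerivAt g (ψ s - s • y) s := by
    intro s
    have h2 : HasDerivAt (fun s : ℝ => s ^ 2 / 2) s s := by
      refine ((hasDerivAt_pow 2 s).div_const 2).congr_deriv ?_
      simp
    exact (hφ s).sub (h2.smul_const y)
  have hb : ∀ s ∈ Set.Icc (-|t|) |t|, ‖ψ s - s • y‖ ≤ ε / 4 * |t| := by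
    intro s hs
    have hs' : |s| ≤ |t| := abs_le.2 hs
    have h2 := hδ' (y := s) (by rw [dist_zero_right, Real.norm_eq_abs]; linarith)
    simp only [hψ0, sub_zero, Real.norm_eq_abs] at h2
    exact h2.trans (by gcongr)
  have h3 := (convex_Icc (-|t|) |t|).norm_image_sub_le_of_norm_hasDerivWithin_le
    (f := g) (fun s _ => (hgd s).hasDerivWithinAt) hb
    (show (0 : ℝ) ∈ _ from ⟨by simp, abs_nonneg t⟩)
    (show t ∈ _ from ⟨neg_abs_le t, le_abs_self t⟩)
  rw [dist_eq_norm]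
  have h4 : (2 / t ^ 2) • (φ t - φ 0) - y = (2 / t ^ 2) • (g t - g 0) := by
    have h5 : (2 / t ^ 2) * (t ^ 2 / 2) = 1 := by field_simp
    simp only [hg]
    rw [smul_sub, smul_sub, smul_sub, smul_sub, smul_smul, h5]
    simp
    abel
  rw [h4, norm_smul, Real.norm_of_nonneg (by positivity)]
  have h5 : ‖t - 0‖ = |t| := by simp
  rw [h5] at h3
  calc 2 / t ^ 2 * ‖g t - g 0‖ ≤ 2 / t ^ 2 * (ε / 4 * |t| * |t|) := by gcongr
    _ = ε / 2 := by
      rw [mul_assoc (ε / 4), abs_mul_abs_self]; field_simp; norm_num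
    _ < ε := by linarith

variable [CompleteSpace E] [CompleteSpace F]

/-- In `(w, l i w) = R (0, l² i w - K w)` the `F`-component on the right has cancelled, so `‖w‖` is
controlled by norms in `E` alone. -/
theorem IsReductionGroup.exists_norm_le {K : E →ₗ.[ℂ] E} {i : F →L[ℂ] E}
    {U : ℝ → (F × E) →L[ℂ] (F × E)} (hU : IsReductionGroup K i U) :
    ∃ c : ℝ, ∀ (w : F) (h : i w ∈ K.domain), ‖w‖ ≤ c * (‖i w‖ + ‖K ⟨i w, h⟩‖) := by
  obtain ⟨l, R, hR, -⟩ := exists_isResolvent hU.1 one_pos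
  refine ⟨‖R‖ * (‖(l : ℂ)‖ ^ 2 + 1), fun w h => ?_⟩
  have h1 := hR.left_inv (w, (l : ℂ) • i w) ((l : ℂ) • w, K ⟨i w, h⟩)
    ((hU.2 _ _ _ _).2 ⟨map_smul _ _ _, mem_graph_iff_exists.2 ⟨h, rfl⟩⟩)
  rw [Prod.smul_mk, Prod.mk_sub_mk, sub_self, smul_smul] at h1
  have h2 : ‖((0 : F), ((l : ℂ) * l) • i w - K ⟨i w, h⟩)‖
      ≤ (‖(l : ℂ)‖ ^ 2 + 1) * (‖i w‖ + ‖K ⟨i w, h⟩‖) := by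
    rw [Prod.norm_mk, norm_zero, max_eq_right (norm_nonneg _)]
    refine (norm_sub_le _ _).trans ?_
    rw [norm_smul, norm_mul, ← pow_two]
    nlinarith [norm_nonneg (i w), mul_nonneg (sq_nonneg ‖(l : ℂ)‖) (norm_nonneg (K ⟨i w, h⟩))]
  calc ‖w‖ ≤ ‖(w, (l : ℂ) • i w)‖ := norm_fst_le (w, (l : ℂ) • i w)
    _ = ‖R ((0 : F), ((l : ℂ) * l) • i w - K ⟨i w, h⟩)‖ := by rw [h1]
    _ ≤ ‖R‖ * ((‖(l : ℂ)‖ ^ 2 + 1) * (‖i w‖ + ‖K ⟨i w, h⟩‖)) := R.le_opNorm_of_le h2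
    _ = _ := (mul_assoc _ _ _).symm

/-- Conjugation by the reflection negates the reduction matrix, which upgrades the semigroup to a
group. The graph-norm bound comes for free from the resolvent. -/
theorem isKisynskiSpace_iff {K : E →ₗ.[ℂ] E} {i : F →L[ℂ] E} {hi : Function.Injective i} :
    IsKisynskiSpace K i hi ↔ (∀ u ∈ K.domain, ∃ w : F, i w = u) ∧
      Dense {w : F | i w ∈ K.domain} ∧ DenseRange i ∧ ∃ U, IsReductionGroup K i U := by
  constructor
  · intro h
    refine ⟨h.domain_le, h.dense_domain, h.dense_range, ?_⟩
    obtain ⟨T, hT, hG⟩ := h.generates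
    obtain ⟨U, hU, hUG⟩ := exists_group_of_semigroup hT hG (reflection F E)
      (fun x => by simp [reflection_apply])
      (by
        rintro ⟨f, e⟩ ⟨f', e'⟩ hg
        rw [mem_graph_reductionMatrix] at hg
        rw [reflection_apply, reflection_apply]
        simp only [Prod.neg_mk, neg_neg]
        rw [mem_graph_reductionMatrix, map_neg, hg.1]
        exact ⟨rfl, hg.2⟩)
      (h.dense_domain.prod h.dense_range)
    exact ⟨U, hU, fun f e f' e' => by rw [← hUG, mem_graph_reductionMatrix]⟩
  · rintro ⟨h1, h2, h3, U, hU⟩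
    refine ⟨h1, hU.exists_norm_le, h2, h3, U, hU.1.isC0Semigroup, ?_⟩
    rintro ⟨f, e⟩ ⟨f', e'⟩
    rw [mem_graph_reductionMatrix, ← gen_iff_tendsto_right hU.1, hU.2]

/-- Time reversal: the diagonal entries of the group are even in `t`, the off-diagonal ones odd. -/
theorem IsReductionGroup.reflection_apply_eq {K : E →ₗ.[ℂ] E} {i : F →L[ℂ] E}
    {U : ℝ → (F × E) →L[ℂ] (F × E)} (hU : IsReductionGroup K i U) (t : ℝ) (p : F × E) :
    reflection F E (U t p) = U (-t) (reflection F E p) := by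
  refine intertwine hU.1.neg hU.1 (reflection F E) (dense_gen_domain hU.1) ?_ t p
  rintro ⟨f, e⟩ ⟨f', e'⟩ h
  rw [hU.2] at h
  rw [gen_neg_iff, reflection_apply, reflection_apply]
  simp only [Prod.neg_mk, neg_neg]
  rw [hU.2, map_neg, h.1]
  exact ⟨rfl, h.2⟩

/-- The lower right entry of the group generated by the reduction matrix is a cosine function. -/
theorem IsReductionGroup.generatesCosine {K : E →ₗ.[ℂ] E} {i : F →L[ℂ] E}
    {U : ℝ → (F × E) →L[ℂ] (F × E)} (hU : IsReductionGroup K i U) (hK : K.IsClosed)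
    (hdom : ∀ u ∈ K.domain, ∃ w : F, i w = u) : GeneratesCosine K := by
  have hUc := hU.1.strongly_continuous
  refine ⟨fun t => (ContinuousLinearMap.snd ℂ F E).comp
    ((U t).comp (ContinuousLinearMap.inr ℂ F E)), ⟨fun x => ?_, fun t s => ?_, ?_⟩, fun x y => ?_⟩
  · exact continuous_snd.comp (hUc _)
  · ext x
    change (U (t + s) (0, x)).2 + (U (t - s) (0, x)).2 = (2 : ℂ) • (U t (0, (U s (0, x)).2)).2
    -- By this parity the `F`-components of `U s (0, x)` and `U (-s) (0, x)` cancel in the sum,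
    -- which leaves D'Alembert's relation.
    have h1 : U (-s) (0, x) = (-(U s (0, x)).1, (U s (0, x)).2) := by
      have := hU.reflection_apply_eq s (0, x)
      rw [reflection_apply, reflection_apply] at this
      have h2 : ((0 : F), -x) = -(0, x) := by simp
      simp only at this
      rw [h2, map_neg, ← neg_eq_iff_eq_neg] at this
      rw [← this]; simp
    rw [sub_eq_add_neg, hU.1.apply_add, hU.1.apply_add, h1]
    have h2 : U t (U s (0, x)) + U t (-(U s (0, x)).1, (U s (0, x)).2)
        = (2 : ℂ) • U t (0, (U s (0, x)).2) := by
      rw [← map_add, ← map_smul]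
      congr 1
      ext <;> simp [two_smul]
    simpa using congrArg Prod.snd h2
  · ext x; simp [hU.1.map_zero]
  · change _ ↔ Tendsto (fun t : ℝ => (2 / t ^ 2) • ((U t (0, x)).2 - x)) (𝓝[≠] 0) (𝓝 y)
    have hd2 : ∀ {w : ℝ → F × E} {p : F × E} {t : ℝ}, HasDerivAt w p t →
        HasDerivAt (fun t => (w t).2) p.2 t := fun {w p t} h =>
      (ContinuousLinearMap.snd ℝ F E).hasFDerivAt.comp_hasDerivAt t h
    have hd1 : ∀ {w : ℝ → F × E} {p : F × E} {t : ℝ}, HasDerivAt w p t →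
        HasDerivAt (fun t => i (w t).1) (i p.1) t := fun {w p t} h =>
      ((i.comp (ContinuousLinearMap.fst ℂ F E)).restrictScalars ℝ).hasFDerivAt.comp_hasDerivAt t h
    constructor
    · intro hxy
      obtain ⟨f, rfl⟩ := hdom x (LinearPMap.mem_domain_iff.2 ⟨y, hxy⟩)
      have hg1 : Gen U (0, i f) (f, 0) := (hU.2 _ _ _ _).2 ⟨rfl, by
        rw [map_zero]; exact K.graph.zero_mem⟩
      have hg2 : Gen U (f, 0) (0, y) := (hU.2 _ _ _ _).2 ⟨map_zero i, hxy⟩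
      have h1 := tendsto_two_div_sq_smul (φ := fun t => (U t (0, i f)).2)
        (ψ := fun t => (U t (f, 0)).2) (fun t => hd2 (hg1.hasDerivAt hU.1 t))
        (by simp [hU.1.apply_zero]) (hd2 hg2)
      simpa [hU.1.apply_zero] using h1
    · intro hlim
      -- To bound the domain of the generator from above: `C t x - x` is `K` applied to the first
      -- component of `I t`, and `2 / t ^ 2` times that component tends to `x`. Closedness of `K`
      -- concludes.
      set I : ℝ → F × E := fun t => ∫ s in (0 : ℝ)..t, U s (0, x) with hI
      have hId : ∀ t, HasDerivAt I (U t (0, x)) t := fun t =>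
        intervalIntegral.integral_hasDerivAt_right ((hUc _).intervalIntegrable _ _)
          ((hUc _).stronglyMeasurableAtFilter _ _) (hUc _).continuousAt
      have hIg : ∀ t, i (U t (0, x)).1 = (I t).2 ∧ (i (I t).1, (U t (0, x)).2 - x) ∈ K.graph := by
        intro t
        have h1 := gen_integral hU.1 (0, x) t
        have h2 := (hU.2 (I t).1 (I t).2 (U t (0, x) - (0, x)).1 (U t (0, x) - (0, x)).2).1 h1
        simpa using h2
      have hI0 : I 0 = 0 := by simp [hI]
      have h1 := tendsto_two_div_sq_smul (φ := fun t => i (I t).1) (ψ := fun t => (I t).2)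
        (fun t => by rw [← (hIg t).1]; exact hd1 (hId t)) (by rw [hI0]; rfl) (hd2 (hId 0))
      rw [hU.1.apply_zero] at h1
      refine IsClosed.mem_of_tendsto (b := 𝓝[≠] (0 : ℝ)) hK (h1.prodMk_nhds hlim)
        (Eventually.of_forall fun t => ?_)
      have := K.graph.smul_mem (((2 / t ^ 2 : ℝ)) : ℂ) (hIg t).2
      rw [Complex.coe_smul] at this
      simpa [hI0] using this

theorem IsReductionGroup.dense_domain {K : E →ₗ.[ℂ] E} {i : F →L[ℂ] E}
    {U : ℝ → (F × E) →L[ℂ] (F × E)} (hU : IsReductionGroup K i U) :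
    Dense {w : F | i w ∈ K.domain} := by
  refine (Prod.fst_surjective.denseRange.dense_image continuous_fst
    (dense_gen_domain hU.1)).mono ?_
  rintro _ ⟨⟨f, e⟩, ⟨⟨f', e'⟩, h⟩, rfl⟩
  exact LinearPMap.mem_domain_of_mem_graph ((hU.2 _ _ _ _).1 h).2

theorem IsReductionGroup.denseRange {K : E →ₗ.[ℂ] E} {i : F →L[ℂ] E}
    {U : ℝ → (F × E) →L[ℂ] (F × E)} (hU : IsReductionGroup K i U) : DenseRange i := by
  refine (Prod.snd_surjective.denseRange.dense_image continuous_snd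
    (dense_gen_domain hU.1)).mono ?_
  rintro _ ⟨⟨f, e⟩, ⟨⟨f', e'⟩, h⟩, rfl⟩
  exact ⟨f', ((hU.2 _ _ _ _).1 h).1⟩

theorem generatesCosineWithPhaseSpace_iff {K : E →ₗ.[ℂ] E} {i : F →L[ℂ] E}
    {hi : Function.Injective i} (hK : K.IsClosed) (hdom : ∀ u ∈ K.domain, ∃ w : F, i w = u) :
    GeneratesCosineWithPhaseSpace K i hi ↔ ∃ U, IsReductionGroup K i U := by
  rw [GeneratesCosineWithPhaseSpace, isKisynskiSpace_iff]
  refine ⟨fun h => h.2.2.2.2, fun ⟨U, hU⟩ =>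
    ⟨hU.generatesCosine hK hdom, hdom, hU.dense_domain, hU.denseRange, U, hU⟩⟩

end Reduction

/-! ### First order Cauchy problems -/

section AbstractCauchyProblem

variable {H : Type*} [NormedAddCommGroup H] [NormedSpace ℂ H]

/-- `w`, with derivative `w'`, is a `C¹` solution on `ℝ` of `w' = G w`. -/
structure IsCauchySolution (G : H →ₗ.[ℂ] H) (w w' : ℝ → H) : Prop where
  hasDerivAt : ∀ t, HasDerivAt w (w' t) t
  continuous_deriv : Continuous w'
  mem_graph : ∀ t, (w t, w' t) ∈ G.graph

variable {G : H →ₗ.[ℂ] H}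

theorem IsCauchySolution.add {w w' v v' : ℝ → H} (hw : IsCauchySolution G w w')
    (hv : IsCauchySolution G v v') : IsCauchySolution G (w + v) (w' + v') :=
  ⟨fun t => (hw.1 t).add (hv.1 t), hw.2.add hv.2, fun t => G.graph.add_mem (hw.3 t) (hv.3 t)⟩

theorem IsCauchySolution.smul {w w' : ℝ → H} (c : ℂ) (hw : IsCauchySolution G w w') :
    IsCauchySolution G (c • w) (c • w') :=
  ⟨fun t => (hw.1 t).const_smul c, hw.2.const_smul c, fun t => G.graph.smul_mem c (hw.3 t)⟩

theorem IsCauchySolution.shift {w w' : ℝ → H} (s : ℝ) (hw : IsCauchySolution G w w') :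
    IsCauchySolution G (fun t => w (t + s)) (fun t => w' (t + s)) :=
  ⟨fun t => (hw.1 _).comp_add_const t s, hw.2.comp (continuous_add_const s), fun _ => hw.3 _⟩

theorem IsCauchySolution.continuous {w w' : ℝ → H} (hw : IsCauchySolution G w w') :
    Continuous w :=
  continuous_iff_continuousAt.2 fun t => (hw.1 t).continuousAt

/-- A well-posed abstract Cauchy problem is governed by a strongly continuous group. -/
theorem exists_group_of_isCauchySolution [CompleteSpace H] (hGc : G.IsClosed)
    (hGd : Dense (G.domain : Set H))
    (hex : ∀ x ∈ G.domain, ∃ w w', IsCauchySolution G w w' ∧ w 0 = x)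
    (hbd : ∀ r : ℝ, ∃ M : ℝ, ∀ w w', IsCauchySolution G w w' → ∀ t, |t| ≤ r →
      ‖w t‖ ≤ M * ‖w 0‖) :
    ∃ U : ℝ → H →L[ℂ] H, IsC0Group U ∧ ∀ x y, (x, y) ∈ G.graph ↔ Gen U x y := by
  -- Uniqueness is the a priori bound applied to the difference of two solutions.
  have huniq : ∀ {w w' v v'}, IsCauchySolution G w w' → IsCauchySolution G v v' → w 0 = v 0 →
      ∀ t, w t = v t := by
    intro w w' v v' hw hv h0 t
    obtain ⟨M, hM⟩ := hbd |t|
    have h1 := hM _ _ (hw.add (hv.smul (-1))) t le_rfl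
    have h2 : (w + (-1 : ℂ) • v) 0 = 0 := by simp [h0]
    rw [h2, norm_zero, mul_zero, norm_le_zero_iff] at h1
    rw [← sub_eq_zero]
    simpa [sub_eq_add_neg] using h1
  choose w w' hw hw0 using hex
  have hgr : ∀ {x}, (hx : x ∈ G.domain) → ∀ t, w x hx t ∈ G.domain := fun {x} hx t =>
    LinearPMap.mem_domain_of_mem_graph ((hw x hx).3 t)
  let W : ℝ → G.domain →ₗ[ℂ] H := fun t =>
    { toFun := fun x => w x x.2 t
      map_add' := fun x y => huniq (hw _ _) ((hw _ _).add (hw _ _)) (by simp [hw0]) t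
      map_smul' := fun c x => huniq (hw _ _) ((hw _ _).smul c) (by simp [hw0]) t }
  choose! M hM using hbd
  have hWb : ∀ r t, |t| ≤ r → ∀ x, ‖W t x‖ ≤ M r * ‖(x : H)‖ := fun r t ht x => by
    have := hM r _ _ (hw x x.2) t ht
    rwa [hw0] at this
  have hdr : DenseRange (G.domain.subtypeL : G.domain →L[ℂ] H) := by
    rw [DenseRange]; simpa using hGd
  -- The solution operators are bounded on the dense domain, locally uniformly in `t`; so their
  -- extensions remain strongly continuous.
  set U : ℝ → H →L[ℂ] H := fun t => (W t).extendOfNorm (G.domain.subtypeL : G.domain →L[ℂ] H)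
    with hUdef
  have hU : ∀ t x (hx : x ∈ G.domain), U t x = w x hx t := fun t x hx =>
    LinearMap.extendOfNorm_eq hdr ⟨M |t|, hWb |t| t le_rfl⟩ (⟨x, hx⟩ : G.domain)
  have hUb : ∀ r t, |t| ≤ r → ∀ x, ‖U t x‖ ≤ M r * ‖x‖ := fun r t ht x =>
    hGd.induction (P := fun x => ‖U t x‖ ≤ M r * ‖x‖)
      (fun x hx => by rw [hU t x hx]; exact hWb r t ht ⟨x, hx⟩)
      (isClosed_le (by fun_prop) (by fun_prop)) x
  have hUc : ∀ x, Continuous fun t => U t x := by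
    intro x
    rw [continuous_iff_continuousAt]
    intro t₀
    rw [ContinuousAt, Metric.tendsto_nhds]
    intro ε hε
    set C := |M (|t₀| + 1)| + 1 with hC
    have hC0 : 0 < C := by positivity
    obtain ⟨y, hy, hxy⟩ := Metric.dense_iff.1 hGd x (ε / (4 * C)) (by positivity)
    have hxy' : ‖x - y‖ ≤ ε / (4 * C) := by
      rw [← dist_eq_norm, dist_comm]; exact (Metric.mem_ball.1 hy).le
    have h1 : ∀ t, |t| ≤ |t₀| + 1 → ‖U t x - U t y‖ ≤ ε / 4 := by
      intro t ht
      rw [← map_sub]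
      calc ‖U t (x - y)‖ ≤ M (|t₀| + 1) * ‖x - y‖ := hUb _ t ht _
        _ ≤ C * (ε / (4 * C)) := by
          gcongr
          linarith [le_abs_self (M (|t₀| + 1))]
        _ = ε / 4 := by field_simp
    have h2 : Continuous fun t => U t y := by
      simp_rw [hU _ y hxy]; exact (hw y hxy).continuous
    have h3 : ∀ᶠ t in 𝓝 t₀, |t| < |t₀| + 1 :=
      (continuous_abs.tendsto t₀).eventually_lt_const (by simp)
    filter_upwards [h3, Metric.tendsto_nhds.1 (h2.tendsto t₀) (ε / 4) (by positivity)] with t ht ht'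
    rw [dist_eq_norm] at ht' ⊢
    have h4 : U t x - U t₀ x = (U t x - U t y) + (U t y - U t₀ y) - (U t₀ x - U t₀ y) := by abel
    rw [h4]
    have h5 := norm_sub_le ((U t x - U t y) + (U t y - U t₀ y)) (U t₀ x - U t₀ y)
    have h6 := norm_add_le (U t x - U t y) (U t y - U t₀ y)
    linarith [h1 t ht.le, h1 t₀ (by linarith)]
  have hext : ∀ {A B : H →L[ℂ] H}, (∀ x ∈ G.domain, A x = B x) → A = B := fun {A B} h => by
    ext x
    exact hGd.induction (P := fun x => A x = B x) h (isClosed_eq (by fun_prop) (by fun_prop)) x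
  have hgroup : IsC0Group U := by
    refine ⟨hext fun x hx => ?_, fun s t => hext fun x hx => ?_, hUc⟩
    · rw [hU _ _ hx, hw0]; rfl
    · rw [ContinuousLinearMap.comp_apply, hU _ _ hx, hU _ _ hx, hU _ _ (hgr hx t)]
      exact huniq ((hw x hx).shift t) (hw _ (hgr hx t)) (by simp [hw0]) s
  refine ⟨U, hgroup, fun x y => ⟨fun hxy => ?_, fun hxy => ?_⟩⟩
  · have hx := LinearPMap.mem_domain_of_mem_graph hxy
    have h1 := (hw x hx).1 0
    have h2 := (hw x hx).3 0
    rw [hw0] at h2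
    rw [G.mem_graph_snd_inj h2 hxy rfl] at h1
    exact h1.congr_of_eventuallyEq (Eventually.of_forall fun t => hU t x hx)
  -- The generator of `U` is not larger than `G`: the integrated equation holds on `D(G)`, extends
  -- to all `x` by closedness, and is then divided by `t`.
  · have hint : ∀ t x, ((∫ s in (0 : ℝ)..t, U s x), U t x - x) ∈ G.graph := by
      intro t x
      obtain ⟨I, hI⟩ := exists_strongIntegral hUc t
      rw [← hI]
      refine hGd.induction (P := fun x => (I x, U t x - x) ∈ G.graph) (fun x hx => ?_)
        (IsClosed.preimage (f := fun x => (I x, U t x - x)) (by fun_prop) hGc) x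
      have hc : Continuous fun s => (w x hx s, w' x hx s) :=
        (hw x hx).continuous.prodMk (hw x hx).2
      have h1 := integral_mem_of_isClosed G.graph hGc hc (hw x hx).3 t
      have h2 : ∫ s in (0 : ℝ)..t, (w x hx s, w' x hx s) = (I x, U t x - x) := by
        refine Prod.ext ?_ ?_
        · have := ContinuousLinearMap.intervalIntegral_comp_comm (ContinuousLinearMap.fst ℝ H H)
            (hc.intervalIntegrable (μ := MeasureTheory.volume) 0 t)
          rw [hI]
          simp_rw [hU _ x hx]
          exact this.symm
        · have := ContinuousLinearMap.intervalIntegral_comp_comm (ContinuousLinearMap.snd ℝ H H)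
            (hc.intervalIntegrable (μ := MeasureTheory.volume) 0 t)
          refine this.symm.trans ?_
          change ∫ s in (0 : ℝ)..t, w' x hx s = _
          rw [intervalIntegral.integral_eq_sub_of_hasDerivAt (fun s _ => (hw x hx).1 s)
            ((hw x hx).2.intervalIntegrable _ _), hw0, hU t x hx]
      rwa [h2] at h1
    have hd : HasDerivAt (fun h => ∫ s in (0 : ℝ)..h, U s x) (U 0 x) 0 :=
      intervalIntegral.integral_hasDerivAt_right ((hUc x).intervalIntegrable _ _)
        ((hUc x).stronglyMeasurableAtFilter _ _) (hUc x).continuousAt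
    rw [Gen, hasDerivAt_iff_tendsto_slope_zero] at hxy
    rw [hasDerivAt_iff_tendsto_slope_zero] at hd
    simp only [zero_add, hgroup.apply_zero, intervalIntegral.integral_same, sub_zero] at hxy hd
    refine IsClosed.mem_of_tendsto (b := 𝓝[≠] (0 : ℝ)) hGc (hd.prodMk_nhds hxy)
      (Eventually.of_forall fun t => ?_)
    have := G.graph.smul_mem ((t⁻¹ : ℝ) : ℂ) (hint t x)
    rwa [Complex.coe_smul] at this

end AbstractCauchyProblem

/-! ### Second order problems and well-posedness -/

section SecondOrder

variable {E F : Type*} [NormedAddCommGroup E] [NormedSpace ℂ E]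
  [NormedAddCommGroup F] [NormedSpace ℂ F] {K : E →ₗ.[ℂ] E} {i : F →L[ℂ] E}
  {hi : Function.Injective i}

theorem isClosed_reductionMatrix (hK : K.IsClosed) : (reductionMatrix K i hi).IsClosed := by
  have h1 : ((reductionMatrix K i hi).graph : Set ((F × E) × (F × E))) =
      {p | i p.2.1 = p.1.2} ∩ (fun p : (F × E) × (F × E) => (i p.1.1, p.2.2)) ⁻¹' K.graph := by
    ext ⟨⟨f, e⟩, ⟨f', e'⟩⟩
    exact mem_graph_reductionMatrix
  change IsClosed ((reductionMatrix K i hi).graph : Set ((F × E) × (F × E)))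
  rw [h1]
  exact (isClosed_eq (by fun_prop) (by fun_prop)).inter (IsClosed.preimage (by fun_prop) hK)

/-- `C¹` into `F` together with `C²` into `E` is exactly the regularity that makes `(u, i u')` a
`C¹` curve in `F × E`. -/
theorem IsClassicalSolution.isCauchySolution {u : ℝ → F} (hu : IsClassicalSolution K i u) :
    IsCauchySolution (reductionMatrix K i hi) (fun t => (u t, i (deriv u t)))
      (fun t => (deriv u t, deriv (deriv fun s => i (u s)) t)) := by
  have h1 : ∀ t, HasDerivAt u (deriv u t) t := fun t =>
    (hu.contDiff_one.differentiable one_ne_zero t).hasDerivAt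
  have h2 : (deriv fun s => i (u s)) = fun t => i (deriv u t) := by
    funext t
    exact ((i.restrictScalars ℝ).hasFDerivAt.comp_hasDerivAt t (h1 t)).deriv
  have h3 : ContDiff ℝ 1 (deriv fun s => i (u s)) := by
    have h4 : ContDiff ℝ (1 + 1) fun s => i (u s) := by
      simpa [one_add_one_eq_two] using hu.contDiff_two
    exact (contDiff_succ_iff_deriv.1 h4).2.2
  refine ⟨fun t => (h1 t).prodMk ?_, ?_, fun t => ?_⟩
  · have h4 := (h3.differentiable one_ne_zero t).hasDerivAt
    rwa [h2] at h4 ⊢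
  · exact (hu.contDiff_one.continuous_deriv le_rfl).prodMk (h3.continuous_deriv le_rfl)
  · rw [mem_graph_reductionMatrix, mem_graph_iff_exists]
    obtain ⟨h, he⟩ := hu.equation t
    exact ⟨rfl, h, he.symm⟩

theorem IsCauchySolution.isClassicalSolution {w w' : ℝ → F × E}
    (hw : IsCauchySolution (reductionMatrix K i hi) w w') :
    IsClassicalSolution K i (fun t => (w t).1) ∧
      ∀ t, deriv (fun t => (w t).1) t = (w' t).1 ∧ i (w' t).1 = (w t).2 := by
  have hgr : ∀ t, i (w' t).1 = (w t).2 ∧ (i (w t).1, (w' t).2) ∈ K.graph := fun t =>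
    mem_graph_reductionMatrix.1 (hw.3 t)
  have h1 : ∀ t, HasDerivAt (fun t => (w t).1) (w' t).1 t := fun t =>
    (ContinuousLinearMap.fst ℝ F E).hasFDerivAt.comp_hasDerivAt t (hw.1 t)
  have h2 : ∀ t, HasDerivAt (fun t => (w t).2) (w' t).2 t := fun t =>
    (ContinuousLinearMap.snd ℝ F E).hasFDerivAt.comp_hasDerivAt t (hw.1 t)
  have h3 : ∀ t, HasDerivAt (fun t => i (w t).1) (w t).2 t := fun t => by
    rw [← (hgr t).1]
    exact (i.restrictScalars ℝ).hasFDerivAt.comp_hasDerivAt t (h1 t)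
  have d1 : deriv (fun t => (w t).1) = fun t => (w' t).1 := funext fun t => (h1 t).deriv
  have d2 : deriv (fun t => (w t).2) = fun t => (w' t).2 := funext fun t => (h2 t).deriv
  have d3 : deriv (fun t => i (w t).1) = fun t => (w t).2 := funext fun t => (h3 t).deriv
  refine ⟨⟨?_, ?_, fun t => ?_⟩, fun t => ⟨(h1 t).deriv, (hgr t).1⟩⟩
  · rw [contDiff_one_iff_deriv, d1]
    exact ⟨fun t => (h1 t).differentiableAt, continuous_fst.comp hw.2⟩
  · rw [← one_add_one_eq_two, contDiff_succ_iff_deriv, d3, contDiff_one_iff_deriv, d2]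
    exact ⟨fun t => (h3 t).differentiableAt, by simp,
      fun t => (h2 t).differentiableAt, continuous_snd.comp hw.2⟩
  · obtain ⟨h, he⟩ := mem_graph_iff_exists.1 (hgr t).2
    exact ⟨h, by rw [d3, d2, he]⟩

/-- Start at `0` with velocity `g`: the quotients `u t / t` lie in the domain and tend to `g` in
`F`. -/
theorem IsWellPosed.dense_domain (h : IsWellPosed K i) : Dense {w : F | i w ∈ K.domain} := by
  intro g
  obtain ⟨u, ⟨hu, hu0, hu1⟩, -⟩ := h.1 0 g
  have h1 : HasDerivAt u g 0 := by
    rw [← hu1]; exact (hu.contDiff_one.differentiable one_ne_zero 0).hasDerivAt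
  rw [hasDerivAt_iff_tendsto_slope_zero] at h1
  refine mem_closure_of_tendsto h1 (Eventually.of_forall fun t => ?_)
  have hm : ∀ t, i (u t) ∈ K.domain := fun t => (hu.equation t).1
  change i ((t⁻¹ : ℝ) • (u (0 + t) - u 0)) ∈ K.domain
  rw [← Complex.coe_smul, map_smul, map_sub]
  exact K.domain.smul_mem _ (K.domain.sub_mem (hm _) (hm _))

variable [CompleteSpace E] [CompleteSpace F]

theorem IsReductionGroup.isWellPosed (hi : Function.Injective i)
    {U : ℝ → (F × E) →L[ℂ] (F × E)} (hU : IsReductionGroup K i U)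
    (hdom : ∀ u ∈ K.domain, ∃ w : F, i w = u) : IsWellPosed K i := by
  have hsol : ∀ u, IsClassicalSolution K i u →
      ∀ t, (u t, i (deriv u t)) = U t (u 0, i (deriv u 0)) := by
    intro u hu t
    have h := hu.isCauchySolution (hi := hi)
    refine eq_apply_of_hasDerivAt hU.1 h.1 (fun t => ?_) t
    exact (hU.2 _ _ _ _).2 (mem_graph_reductionMatrix.1 (h.3 t))
  refine ⟨fun f g => ?_, fun r => ?_⟩
  · obtain ⟨f₀, hf₀⟩ := hdom f f.2
    have hg : Gen U (f₀, i g) (g, K f) := (hU.2 _ _ _ _).2 ⟨rfl, by rw [hf₀]; exact K.mem_graph f⟩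
    have hw : IsCauchySolution (reductionMatrix K i hi) (fun t => U t (f₀, i g))
        (fun t => U t (g, K f)) :=
      ⟨fun t => hg.hasDerivAt hU.1 t, hU.1.strongly_continuous _, fun t =>
        mem_graph_reductionMatrix.2 ((hU.2 _ _ _ _).1 (hg.apply hU.1 t))⟩
    obtain ⟨h1, h2⟩ := hw.isClassicalSolution
    refine ⟨_, ⟨h1, ?_, ?_⟩, ?_⟩
    · simp only [hU.1.apply_zero]; exact hf₀
    · rw [(h2 0).1, hU.1.apply_zero]
    · rintro v ⟨hv, hv0, hv1⟩
      funext t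
      have h3 := hsol v hv t
      rw [hv1, hi (hv0.trans hf₀.symm)] at h3
      exact congrArg Prod.fst h3
  · obtain ⟨M, hM1, hM⟩ := exists_norm_le_of_stronglyContinuous hU.1.strongly_continuous r
    refine ⟨2 * M, fun u hu t ht => ?_⟩
    have h1 := hsol u hu t
    have h2 : ‖(u t, i (deriv u t))‖ ≤ M * ‖(u 0, i (deriv u 0))‖ := by
      rw [h1]; exact (U t).le_of_opNorm_le (hM t ht) _
    have h3 := norm_fst_le (u t, i (deriv u t))
    have h4 := norm_snd_le (u t, i (deriv u t))
    have h5 : ‖(u 0, i (deriv u 0))‖ ≤ ‖u 0‖ + ‖i (deriv u 0)‖ :=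
      max_le_add_of_nonneg (norm_nonneg _) (norm_nonneg _)
    have h6 := mul_le_mul_of_nonneg_left h5 (show (0 : ℝ) ≤ M by linarith)
    simp only at h3 h4
    linarith

theorem IsWellPosed.exists_isReductionGroup (hi : Function.Injective i) (h : IsWellPosed K i)
    (hK : K.IsClosed) (hdr : DenseRange i) : ∃ U, IsReductionGroup K i U := by
  obtain ⟨U, hU, hg⟩ := exists_group_of_isCauchySolution (G := reductionMatrix K i hi)
    (isClosed_reductionMatrix hK) (h.dense_domain.prod hdr)
    (by
      rintro ⟨f, e⟩ ⟨hf, ⟨g, hg⟩⟩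
      obtain ⟨u, ⟨hu, hu0, hu1⟩, -⟩ := h.1 ⟨i f, hf⟩ g
      refine ⟨_, _, hu.isCauchySolution, Prod.ext (hi hu0) ?_⟩
      change i (deriv u 0) = e
      rw [hu1]; exact hg)
    (by
      intro r
      obtain ⟨M, hM⟩ := h.2 r
      refine ⟨|M| * 2, fun w w' hw t ht => ?_⟩
      obtain ⟨hu, hd⟩ := hw.isClassicalSolution
      have h1 := hM _ hu t ht
      simp only [(hd _).1, (hd _).2] at h1
      have h2 : ‖w t‖ ≤ ‖(w t).1‖ + ‖(w t).2‖ :=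
        max_le_add_of_nonneg (norm_nonneg _) (norm_nonneg _)
      have h3 : ‖(w 0).1‖ + ‖(w 0).2‖ ≤ 2 * ‖w 0‖ := by
        linarith [norm_fst_le (w 0), norm_snd_le (w 0)]
      calc ‖w t‖ ≤ M * (‖(w 0).1‖ + ‖(w 0).2‖) := h2.trans h1
        _ ≤ |M| * (2 * ‖w 0‖) := by gcongr; exact le_abs_self M
        _ = _ := by ring)
  exact ⟨U, hU, fun f e f' e' => by rw [← hg, mem_graph_reductionMatrix]⟩

/-- Generation of a cosine function with a phase space amounts to well-posedness. -/
theorem generatesCosineWithPhaseSpace_iff_isWellPosed (hK : K.IsClosed)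
    (hdom : ∀ u ∈ K.domain, ∃ w : F, i w = u) (hdr : DenseRange i) :
    GeneratesCosineWithPhaseSpace K i hi ↔ IsWellPosed K i := by
  rw [generatesCosineWithPhaseSpace_iff hK hdom]
  exact ⟨fun ⟨_, hU⟩ => hU.isWellPosed hi hdom, fun h => h.exists_isReductionGroup hi hK hdr⟩

end SecondOrder

/-! ### Similarity and perturbation of reduction groups -/

section Transformations

variable {E F : Type*} [NormedAddCommGroup E] [NormedSpace ℂ E]
  [NormedAddCommGroup F] [NormedSpace ℂ F] {K K' : E →ₗ.[ℂ] E} {i : F →L[ℂ] E}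
  {U : ℝ → (F × E) →L[ℂ] (F × E)}

/-- Similarity transformations compatible with the imbedding preserve reduction groups. -/
theorem IsReductionGroup.exists_conj (hU : IsReductionGroup K i U) (ME : E ≃L[ℂ] E)
    (MF : F ≃L[ℂ] F) (hM : ∀ f, ME (i f) = i (MF f))
    (hK : ∀ x y, (ME x, ME y) ∈ K'.graph ↔ (x, y) ∈ K.graph) :
    ∃ V, IsReductionGroup K' i V := by
  obtain ⟨h1, h2⟩ := hU.1.conj (MF.prodCongr ME)
  refine ⟨_, h1, fun f e f' e' => ?_⟩
  obtain ⟨f, rfl⟩ := MF.surjective f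
  obtain ⟨f', rfl⟩ := MF.surjective f'
  obtain ⟨e, rfl⟩ := ME.surjective e
  obtain ⟨e', rfl⟩ := ME.surjective e'
  rw [h2]
  have h3 : ∀ f e, (MF.prodCongr ME).symm (MF f, ME e) = (f, e) := fun f e => by
    rw [ContinuousLinearEquiv.symm_apply_eq]; rfl
  rw [h3, h3, hU.2, ← hM, ← hM, hK, ME.injective.eq_iff]

/-- The operator `K + i P`, where `P` maps the domain of `K` into `F`. -/
def addOnDomain (K : E →ₗ.[ℂ] E) (i : F →L[ℂ] E) (P : K.domain →ₗ[ℂ] F) : E →ₗ.[ℂ] E where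
  domain := K.domain
  toFun := K.toFun + (i : F →ₗ[ℂ] E).comp P

theorem mem_graph_addOnDomain {P : K.domain →ₗ[ℂ] F} {x y : E} :
    (x, y) ∈ (addOnDomain K i P).graph ↔ ∃ h : x ∈ K.domain, K ⟨x, h⟩ + i (P ⟨x, h⟩) = y :=
  mem_graph_iff_exists

/-- Relatively bounded perturbations with values in the Kisyński space preserve reduction
groups. -/
theorem IsReductionGroup.exists_perturbation [CompleteSpace E] [CompleteSpace F]
    (hi : Function.Injective i) (hU : IsReductionGroup K i U) (P : K.domain →ₗ[ℂ] F) (c : ℝ)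
    (hP : ∀ x, ‖P x‖ ≤ c * (‖(x : E)‖ + ‖K x‖))
    (hK' : ∀ x y, (x, y) ∈ K'.graph ↔ ∃ h : x ∈ K.domain, K ⟨x, h⟩ + i (P ⟨x, h⟩) = y) :
    ∃ V, IsReductionGroup K' i V := by
  let G := reductionMatrix K i hi
  let pr : G.domain →ₗ[ℂ] K.domain :=
    ((i : F →ₗ[ℂ] E).comp (LinearMap.fst ℂ F E)).restrict fun p hp => hp.1
  -- `Q (f, e) = (0, i (P f))`. Since `P f` lies in `F`, this is again in `D(G)` and `G Q (f, e) =
  -- (P f, 0)`, so `Q` is bounded for the graph norm of `G`.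
  let Q : G.domain →ₗ[ℂ] G.domain :=
    LinearMap.codRestrict G.domain
      ((LinearMap.inr ℂ F E).comp ((i : F →ₗ[ℂ] E).comp (P.comp pr))) fun p =>
        ⟨by change i 0 ∈ K.domain; rw [map_zero]; exact K.domain.zero_mem, ⟨_, rfl⟩⟩
  have hQ : ∀ p, (Q p : F × E) = (0, i (P (pr p))) := fun p => rfl
  have hGQ : ∀ p, G (Q p) = (P (pr p), 0) := fun p => by
    have h1 : ((Q p : F × E), (P (pr p), (0 : E))) ∈ G.graph := by
      rw [hQ]
      exact mem_graph_reductionMatrix.2 ⟨rfl, by rw [map_zero]; exact K.graph.zero_mem⟩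
    exact (mem_graph_iff_exists.1 h1).2
  have hGp : ∀ p, (G p).2 = K (pr p) := fun p => rfl
  obtain ⟨V, hV, hg⟩ := exists_relative_perturbation hU.1 G
    (fun ⟨f, e⟩ ⟨f', e'⟩ => by rw [hU.2]; exact mem_graph_reductionMatrix) Q
    ((‖i‖ + 1) * (|c| * (‖i‖ + 1))) fun p => by
      rw [hGQ, hQ, Prod.norm_mk, Prod.norm_mk, norm_zero, norm_zero,
        max_eq_right (norm_nonneg _), max_eq_left (norm_nonneg _)]
      have h1 : ‖(pr p : E)‖ ≤ ‖i‖ * ‖(p : F × E)‖ :=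
        i.le_opNorm_of_le (norm_fst_le (p : F × E))
      have h2 : ‖K (pr p)‖ ≤ ‖G p‖ := by rw [← hGp]; exact norm_snd_le (G p)
      have h3 : ‖P (pr p)‖ ≤ |c| * ((‖i‖ + 1) * (‖(p : F × E)‖ + ‖G p‖)) := by
        refine (hP _).trans ?_
        have h4 : ‖(pr p : E)‖ + ‖K (pr p)‖ ≤ (‖i‖ + 1) * (‖(p : F × E)‖ + ‖G p‖) := by
          nlinarith [norm_nonneg i, norm_nonneg (p : F × E), norm_nonneg (G p),
            mul_nonneg (norm_nonneg i) (norm_nonneg (G p))]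
        refine mul_le_mul (le_abs_self c) h4 (by positivity) (abs_nonneg c)
      calc ‖i (P (pr p))‖ + ‖P (pr p)‖ ≤ ‖i‖ * ‖P (pr p)‖ + ‖P (pr p)‖ := by
            gcongr; exact i.le_opNorm _
        _ = (‖i‖ + 1) * ‖P (pr p)‖ := by ring
        _ ≤ (‖i‖ + 1) * (|c| * ((‖i‖ + 1) * (‖(p : F × E)‖ + ‖G p‖))) := by gcongr
        _ = _ := by ring
  refine ⟨V, hV, fun f e f' e' => ?_⟩
  rw [hg, hK']
  constructor
  · rintro ⟨h, he⟩
    have h1 : ((f, e), (f', e' - i (P ⟨i f, h.1⟩))) ∈ G.graph := by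
      rw [mem_graph_iff_exists]
      refine ⟨h, ?_⟩
      rw [← sub_eq_iff_eq_add.2 he.symm, hQ]
      ext
      · simp
      · rfl
    obtain ⟨h2, h3⟩ := mem_graph_reductionMatrix.1 h1
    obtain ⟨h4, h5⟩ := mem_graph_iff_exists.1 h3
    exact ⟨h2, h4, eq_sub_iff_add_eq.1 h5⟩
  · rintro ⟨h1, h2, h3⟩
    have h4 : ((f, e), (f', K ⟨i f, h2⟩)) ∈ G.graph :=
      mem_graph_reductionMatrix.2 ⟨h1, mem_graph_iff_exists.2 ⟨h2, rfl⟩⟩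
    obtain ⟨h5, h6⟩ := mem_graph_iff_exists.1 h4
    refine ⟨h5, ?_⟩
    rw [h6, hQ, ← h3]
    ext
    · simp
    · rfl

/-- The converse perturbs by `-P`, which is why `P` must also be bounded for the graph norm of `K +
i P`. -/
theorem exists_isReductionGroup_addOnDomain_iff [CompleteSpace E] [CompleteSpace F]
    (hi : Function.Injective i) (P : K.domain →ₗ[ℂ] F) (c c' : ℝ)
    (hP : ∀ x, ‖P x‖ ≤ c * (‖(x : E)‖ + ‖K x‖))
    (hP' : ∀ x : K.domain, ‖P x‖ ≤ c' * (‖(x : E)‖ + ‖K x + i (P x)‖)) :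
    (∃ V, IsReductionGroup (addOnDomain K i P) i V) ↔ ∃ V, IsReductionGroup K i V := by
  constructor
  · rintro ⟨V, hV⟩
    refine hV.exists_perturbation hi (-P) c' (fun x => ?_) fun x y => ?_
    · have h1 : ‖(-P) x‖ = ‖P x‖ := norm_neg _
      exact h1.trans_le (hP' x)
    · rw [mem_graph_iff_exists]
      refine exists_congr fun h => ?_
      have h1 : K ⟨x, h⟩ + i (P ⟨x, h⟩) + i (-(P ⟨x, h⟩)) = K ⟨x, h⟩ := by
        rw [map_neg]
        abel
      exact Eq.congr_left h1.symm
  · rintro ⟨V, hV⟩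
    exact hV.exists_perturbation hi P c hP fun x y => mem_graph_addOnDomain

end Transformations

/-! ### Adding a zero block -/

section Diagonal

variable {X Y : Type*} [NormedAddCommGroup X] [NormedSpace ℂ X]
  [NormedAddCommGroup Y] [NormedSpace ℂ Y]

/-- The diagonal operator matrix `(K 0; 0 0)` on `X × Z`. -/
def diagZero (Z : Type*) [NormedAddCommGroup Z] [NormedSpace ℂ Z] (K : X →ₗ.[ℂ] X) :
    (X × Z) →ₗ.[ℂ] (X × Z) where
  domain := K.domain.comap (LinearMap.fst ℂ X Z)
  toFun := (LinearMap.inl ℂ X Z).comp (K.toFun.comp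
    ((LinearMap.fst ℂ X Z).restrict (p := K.domain.comap (LinearMap.fst ℂ X Z)) fun _ hx => hx))

variable {Z : Type*} [NormedAddCommGroup Z] [NormedSpace ℂ Z] {K : X →ₗ.[ℂ] X} {j : Y →L[ℂ] X}

theorem mem_graph_diagZero {u a : X} {x b : Z} :
    ((u, x), (a, b)) ∈ (diagZero Z K).graph ↔ (u, a) ∈ K.graph ∧ b = 0 := by
  rw [mem_graph_iff_exists, mem_graph_iff_exists]
  constructor
  · rintro ⟨h, he⟩
    obtain ⟨h1, h2⟩ := Prod.ext_iff.1 he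
    exact ⟨⟨h, h1⟩, h2.symm⟩
  · rintro ⟨⟨h, h1⟩, h2⟩
    exact ⟨h, Prod.ext h1 h2.symm⟩

/-- The reduction matrix splits into that of `K` and the bounded nilpotent matrix `(0 I; 0 0)` on `Z
× Z`, whose group is `(z, z') ↦ (z + t z', z')`. In the other direction, the group is restricted to
`Y × X`. -/
theorem exists_isReductionGroup_diagZero_iff [CompleteSpace X] [CompleteSpace Y]
    [CompleteSpace Z] :
    (∃ V, IsReductionGroup (diagZero Z K) (productEmbedding Z j) V) ↔
      ∃ U, IsReductionGroup K j U := by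
  let p : ((Y × Z) × (X × Z)) →L[ℂ] Y × X :=
    (ContinuousLinearMap.fst ℂ Y Z).prodMap (ContinuousLinearMap.fst ℂ X Z)
  let q : (Y × X) →L[ℂ] (Y × Z) × (X × Z) :=
    (ContinuousLinearMap.inl ℂ Y Z).prodMap (ContinuousLinearMap.inl ℂ X Z)
  have hp : ∀ y z x z', p ((y, z), (x, z')) = (y, x) := fun _ _ _ _ => rfl
  have hq : ∀ y x, q (y, x) = ((y, 0), (x, 0)) := fun _ _ => rfl
  have hj : ∀ y z, productEmbedding Z j (y, z) = (j y, z) := fun _ _ => rfl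
  constructor
  · rintro ⟨V, hV⟩
    have hgen : ∀ y z x z' y' w x' w', Gen V ((y, z), (x, z')) ((y', w), (x', w')) ↔
        (j y' = x ∧ w = z') ∧ (j y, x') ∈ K.graph ∧ w' = 0 := fun y z x z' y' w x' w' => by
      rw [hV.2, hj, hj, mem_graph_diagZero, Prod.mk.injEq]
    obtain ⟨U, hU, hUg⟩ := hV.1.exists_restrict p q (fun _ => rfl) (by
      rintro ⟨⟨y, z⟩, ⟨x, z'⟩⟩ ⟨⟨y', w⟩, ⟨x', w'⟩⟩ h
      rw [hgen] at h
      rw [hp, hp, hq, hq, hgen]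
      exact ⟨⟨h.1.1, rfl⟩, h.2.1, rfl⟩)
    refine ⟨U, hU, fun f e f' e' => ?_⟩
    rw [hUg, hq, hq, hgen]
    simp
  · rintro ⟨U, hU⟩
    let n : ((Y × Z) × (X × Z)) →L[ℂ] (Y × Z) × (X × Z) :=
      (ContinuousLinearMap.inl ℂ (Y × Z) (X × Z)).comp ((ContinuousLinearMap.inr ℂ Y Z).comp
        ((ContinuousLinearMap.snd ℂ X Z).comp (ContinuousLinearMap.snd ℂ (Y × Z) (X × Z))))
    let V : ℝ → ((Y × Z) × (X × Z)) →L[ℂ] (Y × Z) × (X × Z) := fun t =>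
      q.comp ((U t).comp p) + (ContinuousLinearMap.id ℂ _ - q.comp p) + (t : ℂ) • n
    have hVapp : ∀ t y z x z', V t ((y, z), (x, z')) =
        (((U t (y, x)).1, z + (t : ℂ) • z'), ((U t (y, x)).2, z')) := by
      intro t y z x z'
      change q (U t (y, x)) + (((y, z), (x, z')) - ((y, 0), (x, 0)))
        + (t : ℂ) • (((0 : Y), z'), ((0 : X), (0 : Z))) = _
      rw [← Prod.mk.eta (p := U t (y, x)), hq]
      simp
    have hV : IsC0Group V := by
      refine ⟨?_, fun s t => ?_, ?_⟩
      · refine ContinuousLinearMap.ext ?_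
        rintro ⟨⟨y, z⟩, ⟨x, z'⟩⟩
        rw [hVapp, hU.1.apply_zero]
        simp
      · refine ContinuousLinearMap.ext ?_
        rintro ⟨⟨y, z⟩, ⟨x, z'⟩⟩
        rw [ContinuousLinearMap.comp_apply, hVapp, hVapp, hVapp, hU.1.apply_add]
        simp only [Prod.mk.eta, Complex.ofReal_add, add_smul]
        congr 2
        abel
      · rintro ⟨⟨y, z⟩, ⟨x, z'⟩⟩
        simp_rw [hVapp]
        have := hU.1.strongly_continuous (y, x)
        fun_prop
    refine ⟨V, hV, ?_⟩
    rintro ⟨y, z⟩ ⟨x, z'⟩ ⟨y', w⟩ ⟨x', w'⟩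
    rw [hj, hj, mem_graph_diagZero, Prod.mk.injEq]
    have hz : HasDerivAt (fun t : ℝ => z + (t : ℂ) • z') z' 0 := by
      have h1 : HasDerivAt (fun t : ℝ => z + t • z') ((1 : ℝ) • z') 0 :=
        ((hasDerivAt_id (0 : ℝ)).smul_const z').const_add z
      simpa [Complex.coe_smul] using h1
    have hgen : Gen V ((y, z), (x, z')) ((y', w), (x', w')) ↔
        Gen U (y, x) (y', x') ∧ w = z' ∧ w' = 0 := by
      constructor
      · intro h
        have h1 := (p.restrictScalars ℝ).hasFDerivAt.comp_hasDerivAt 0 h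
        have h2 := ((ContinuousLinearMap.snd ℝ Y Z).comp
          (ContinuousLinearMap.fst ℝ (Y × Z) (X × Z))).hasFDerivAt.comp_hasDerivAt 0 h
        have h3 := ((ContinuousLinearMap.snd ℝ X Z).comp
          (ContinuousLinearMap.snd ℝ (Y × Z) (X × Z))).hasFDerivAt.comp_hasDerivAt 0 h
        refine ⟨?_, ?_, ?_⟩
        · refine h1.congr_of_eventuallyEq (Eventually.of_forall fun t => ?_)
          change U t (y, x) = p (V t ((y, z), (x, z')))
          rw [hVapp]
          rfl
        · refine HasDerivAt.unique (h2.congr_of_eventuallyEq (Eventually.of_forall fun t => ?_)) hz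
          change _ = (V t ((y, z), (x, z'))).1.2
          rw [hVapp]
        · refine HasDerivAt.unique (h3.congr_of_eventuallyEq (Eventually.of_forall fun t => ?_))
            (hasDerivAt_const 0 z')
          change _ = (V t ((y, z), (x, z'))).2.2
          rw [hVapp]
      · rintro ⟨h, rfl, rfl⟩
        have h1 := (ContinuousLinearMap.fst ℝ Y X).hasFDerivAt.comp_hasDerivAt 0 h
        have h2 := (ContinuousLinearMap.snd ℝ Y X).hasFDerivAt.comp_hasDerivAt 0 h
        have h3 := (h1.prodMk hz).prodMk (h2.prodMk (hasDerivAt_const 0 w))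
        exact h3.congr_of_eventuallyEq (Eventually.of_forall fun t => hVapp t y z x w)
    rw [hgen, hU.2]
    tauto

end Diagonal

/-! ### The coupled operator and its boundary conditions -/

section BoundaryOperators

variable {X Y Z : Type*} [NormedAddCommGroup X] [NormedSpace ℂ X]
  [NormedAddCommGroup Y] [NormedSpace ℂ Y] [NormedAddCommGroup Z] [NormedSpace ℂ Z]
  {A : X →ₗ.[ℂ] X} {L B : A.domain →ₗ[ℂ] Z} {B' : Z →L[ℂ] Z} {j : Y →L[ℂ] X}

theorem productEmbedding_apply (y : Y) (z : Z) : productEmbedding Z j (y, z) = (j y, z) := rfl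

theorem mem_graph_pairOp {u a : X} {z : Z} :
    (u, (a, z)) ∈ (pairOp A L).graph ↔ ∃ h : u ∈ A.domain, A ⟨u, h⟩ = a ∧ L ⟨u, h⟩ = z := by
  rw [mem_graph_iff_exists]
  exact exists_congr fun h => Prod.ext_iff

theorem mem_graph_kerRestrict {u a : X} :
    (u, a) ∈ (kerRestrict A L).graph ↔ ∃ h : u ∈ A.domain, A ⟨u, h⟩ = a ∧ L ⟨u, h⟩ = 0 := by
  rw [mem_graph_iff_exists]
  constructor
  · rintro ⟨⟨⟨v, hv, rfl⟩, h⟩, he⟩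
    exact ⟨h, he, hv⟩
  · rintro ⟨h, he, hv⟩
    exact ⟨⟨⟨⟨u, h⟩, hv, rfl⟩, h⟩, he⟩

theorem mem_graph_coupledMatrix {u a : X} {x b : Z} :
    ((u, x), (a, b)) ∈ (coupledMatrix A L B B').graph ↔
      ∃ h : u ∈ A.domain, L ⟨u, h⟩ = x ∧ A ⟨u, h⟩ = a ∧ B ⟨u, h⟩ + B' x = b := by
  rw [mem_graph_iff_exists]
  constructor
  · rintro ⟨⟨h1, h2⟩, h⟩
    obtain ⟨h3, h4⟩ := Prod.ext_iff.1 h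
    exact ⟨h1, h2, h3, h4⟩
  · rintro ⟨h1, h2, h3, h4⟩
    exact ⟨⟨h1, h2⟩, Prod.ext h3 h4⟩

/-- Convergence in the graph controls `u`, `A u` and `L u = x` at once, so closedness of `(A, L)`
identifies the limit and the bound on `B` carries the last component along. -/
theorem isClosed_coupledMatrix (hAL : (pairOp A L).IsClosed)
    (hB : ∃ c : ℝ, ∀ u : A.domain, ‖B u‖ ≤ c * (‖(u : X)‖ + ‖A u‖ + ‖L u‖)) :
    (coupledMatrix A L B B').IsClosed := by
  obtain ⟨c, hc⟩ := hB
  refine IsSeqClosed.isClosed fun s p hs hsp => ?_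
  obtain ⟨⟨u, x⟩, ⟨a, b⟩⟩ := p
  have hs' : ∀ n, ∃ h : (s n).1.1 ∈ A.domain, L ⟨_, h⟩ = (s n).1.2 ∧ A ⟨_, h⟩ = (s n).2.1 ∧
      B ⟨_, h⟩ + B' (s n).1.2 = (s n).2.2 := fun n => mem_graph_coupledMatrix.1 (hs n)
  choose hd hL hA hBs using hs'
  have h1 : Tendsto (fun n => (s n).1.1) atTop (𝓝 u) :=
    (continuous_fst.fst.tendsto ((u, x), (a, b))).comp hsp
  have h2 : Tendsto (fun n => (s n).1.2) atTop (𝓝 x) :=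
    (continuous_fst.snd.tendsto ((u, x), (a, b))).comp hsp
  have h3 : Tendsto (fun n => (s n).2.1) atTop (𝓝 a) :=
    (continuous_snd.fst.tendsto ((u, x), (a, b))).comp hsp
  have h4 : Tendsto (fun n => (s n).2.2) atTop (𝓝 b) :=
    (continuous_snd.snd.tendsto ((u, x), (a, b))).comp hsp
  have h5 : (u, (a, x)) ∈ (pairOp A L).graph := by
    refine IsClosed.mem_of_tendsto hAL (h1.prodMk_nhds (h3.prodMk_nhds h2))
      (Eventually.of_forall fun n => ?_)
    exact mem_graph_pairOp.2 ⟨hd n, hA n, hL n⟩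
  obtain ⟨h, hAu, hLu⟩ := mem_graph_pairOp.1 h5
  have h6 : Tendsto (fun n => B ⟨_, hd n⟩) atTop (𝓝 (B ⟨u, h⟩)) := by
    rw [tendsto_iff_norm_sub_tendsto_zero]
    have h7 : Tendsto (fun n => c * (‖(s n).1.1 - u‖ + ‖(s n).2.1 - a‖ + ‖(s n).1.2 - x‖)) atTop
        (𝓝 (c * (0 + 0 + 0))) :=
      (((tendsto_iff_norm_sub_tendsto_zero.1 h1).add
        (tendsto_iff_norm_sub_tendsto_zero.1 h3)).add
        (tendsto_iff_norm_sub_tendsto_zero.1 h2)).const_mul c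
    simp only [add_zero, mul_zero] at h7
    refine squeeze_zero (fun _ => norm_nonneg _) (fun n => ?_) h7
    have h8 := hc (⟨_, hd n⟩ - ⟨u, h⟩)
    rw [map_sub, LinearPMap.map_sub, map_sub, hA, hAu, hL, hLu] at h8
    exact h8
  have h9 := tendsto_nhds_unique (h6.add ((B'.continuous.tendsto x).comp h2))
    (h4.congr fun n => (hBs n).symm)
  exact mem_graph_coupledMatrix.2 ⟨h, hLu, hAu, h9⟩

/-- Existence of a Dirichlet operator, i.e. of a bounded right inverse of `L` that takes values in
an eigenspace of `A`. -/
theorem exists_dirichlet_operator [CompleteSpace Y] [CompleteSpace Z]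
    (hj : Function.Injective j) (hAY : ∀ u ∈ A.domain, ∃ y : Y, j y = u)
    (hL : Function.Surjective L) (hres : (DynBdry.resolventSet (kerRestrict A L)).Nonempty)
    (hAL : (pairOp A L).IsClosed) :
    ∃ (l : ℂ) (D : Z →L[ℂ] Y), ∀ z, ∃ h : j (D z) ∈ A.domain,
      A ⟨j (D z), h⟩ = l • j (D z) ∧ L ⟨j (D z), h⟩ = z := by
  obtain ⟨l, R, hR1, hR2⟩ := hres
  -- A difference of two solutions lies in `ker L` and is killed by the injective operator `l - A₀`.
  have huniq : ∀ {y y' : Y} {z : Z}, (j y, (l • j y, z)) ∈ (pairOp A L).graph →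
      (j y', (l • j y', z)) ∈ (pairOp A L).graph → y = y' := by
    intro y y' z hy hy'
    have h1 := (pairOp A L).graph.sub_mem hy hy'
    rw [Prod.mk_sub_mk, Prod.mk_sub_mk, sub_self, ← smul_sub] at h1
    obtain ⟨h2, h3, h4⟩ := mem_graph_pairOp.1 h1
    obtain ⟨h5, h6⟩ := mem_graph_iff_exists.1 (mem_graph_kerRestrict.2 ⟨h2, h3, h4⟩)
    have h7 := hR2 ⟨_, h5⟩
    rw [h6] at h7
    simp only [sub_self, map_zero] at h7
    exact hj (sub_eq_zero.1 h7.symm)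
  -- Take any `u` with `L u = z` and subtract the solution `v` of `(l - A₀) v = (l - A) u`.
  have hex : ∀ z, ∃ y : Y, (j y, (l • j y, z)) ∈ (pairOp A L).graph := by
    intro z
    obtain ⟨u, rfl⟩ := hL z
    obtain ⟨h1, h2⟩ := hR1 (l • (u : X) - A u)
    set v := R (l • (u : X) - A u) with hv
    obtain ⟨h3, h4, h5⟩ := mem_graph_kerRestrict.1 (mem_graph_iff_exists.2 ⟨h1, rfl⟩)
    rw [← h4] at h2
    have h6 := (pairOp A L).graph.sub_mem (mem_graph_pairOp.2 ⟨u.2, rfl, rfl⟩)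
      (mem_graph_pairOp.2 ⟨h3, rfl, h5⟩)
    rw [Prod.mk_sub_mk, Prod.mk_sub_mk, sub_zero] at h6
    have h7 : A u - A ⟨v, h3⟩ = l • ((u : X) - v) := by
      rw [smul_sub]
      have : A u = l • (u : X) - (l • v - A ⟨v, h3⟩) := by rw [h2]; abel
      rw [this]; abel
    obtain ⟨y, hy⟩ := hAY _ (A.domain.sub_mem u.2 h3)
    refine ⟨y, ?_⟩
    rw [hy, ← h7]
    exact h6
  choose d hd using hex
  let D₀ : Z →ₗ[ℂ] Y :=
    { toFun := d
      map_add' := fun z z' => huniq (hd _) (by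
        have := (pairOp A L).graph.add_mem (hd z) (hd z')
        rwa [Prod.mk_add_mk, Prod.mk_add_mk, ← smul_add, ← map_add] at this)
      map_smul' := fun c z => huniq (hd _) (by
        have := (pairOp A L).graph.smul_mem c (hd z)
        rwa [Prod.smul_mk, Prod.smul_mk, smul_comm, ← map_smul] at this) }
  -- Boundedness into `Y`, not merely into `X`, comes from the closed graph theorem, since `Y`
  -- imbeds continuously into `X`.
  have hclosed : ∀ (s : ℕ → Z) (x : Z) (y : Y), Tendsto s atTop (𝓝 x) →
      Tendsto (D₀ ∘ s) atTop (𝓝 y) → y = D₀ x := by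
    intro s x y hs hy
    refine huniq ?_ (hd x)
    have h1 := (j.continuous.tendsto y).comp hy
    exact IsClosed.mem_of_tendsto hAL (h1.prodMk_nhds ((h1.const_smul l).prodMk_nhds hs))
      (Eventually.of_forall fun n => hd (s n))
  exact ⟨l, ContinuousLinearMap.ofSeqClosedGraph hclosed, fun z => mem_graph_pairOp.1 (hd z)⟩

/-- The shear `(e, z) ↦ (e - D z, z)`. -/
def shear {E : Type*} [NormedAddCommGroup E] [NormedSpace ℂ E] (D : Z →L[ℂ] E) :
    (E × Z) ≃L[ℂ] (E × Z) :=
  ContinuousLinearEquiv.equivOfInverse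
    ((ContinuousLinearMap.fst ℂ E Z - D.comp (ContinuousLinearMap.snd ℂ E Z)).prod
      (ContinuousLinearMap.snd ℂ E Z))
    ((ContinuousLinearMap.fst ℂ E Z + D.comp (ContinuousLinearMap.snd ℂ E Z)).prod
      (ContinuousLinearMap.snd ℂ E Z))
    (fun p => by ext <;> simp) (fun p => by ext <;> simp)

/-- The coupled operator matrix and the restriction of `A` to the kernel of `L` have reduction
groups simultaneously. -/
theorem exists_isReductionGroup_coupledMatrix_iff
    [CompleteSpace X] [CompleteSpace Y] [CompleteSpace Z]
    (hj : Function.Injective j) (hAY : ∀ u ∈ A.domain, ∃ y : Y, j y = u)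
    (hL : Function.Surjective L) (hres : (DynBdry.resolventSet (kerRestrict A L)).Nonempty)
    (hAL : (pairOp A L).IsClosed)
    (hB : ∃ c : ℝ, ∀ u : A.domain, ‖B u‖ ≤ c * (‖(u : X)‖ + ‖A u‖ + ‖L u‖)) :
    (∃ U, IsReductionGroup (coupledMatrix A L B B') (productEmbedding Z j) U) ↔
      ∃ U, IsReductionGroup (kerRestrict A L) j U := by
  obtain ⟨l, D, hD⟩ := exists_dirichlet_operator hj hAY hL hres hAL
  obtain ⟨c, hc⟩ := hB
  set K := diagZero Z (kerRestrict A L) with hK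
  have hKd : ∀ p : K.domain, ∃ h : (p : X × Z).1 ∈ A.domain, A ⟨_, h⟩ = (K p).1 ∧
      L ⟨_, h⟩ = 0 := fun p =>
    mem_graph_kerRestrict.1 (mem_graph_iff_exists.2 ⟨p.2, rfl⟩)
  -- the map `(v, z) ↦ v + D z`
  have hlift : ∀ p : K.domain, (p : X × Z).1 + j (D (p : X × Z).2) ∈ A.domain := fun p =>
    A.domain.add_mem (hKd p).1 (hD _).1
  let σ : K.domain →ₗ[ℂ] A.domain := LinearMap.codRestrict A.domain
    (((LinearMap.fst ℂ X Z) + (j : Y →ₗ[ℂ] X).comp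
      ((D : Z →ₗ[ℂ] Y).comp (LinearMap.snd ℂ X Z))).comp K.domain.subtype) hlift
  let q : K.domain →ₗ[ℂ] Z := (LinearMap.snd ℂ X Z).comp K.domain.subtype
  have hσA : ∀ p : K.domain, A (σ p) = (K p).1 + l • j (D (p : X × Z).2) := fun p => by
    have h1 : σ p = ⟨_, (hKd p).1⟩ + ⟨_, (hD (p : X × Z).2).1⟩ := rfl
    rw [h1, LinearPMap.map_add, (hKd p).2.1, (hD _).2.1]
  have hσL : ∀ p : K.domain, L (σ p) = (p : X × Z).2 := fun p => by
    have h1 : σ p = ⟨_, (hKd p).1⟩ + ⟨_, (hD (p : X × Z).2).1⟩ := rfl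
    rw [h1, map_add, (hKd p).2.2, (hD _).2.2, zero_add]
  have hK2 : ∀ p : K.domain, (K p).2 = 0 := fun p => rfl
  -- `w` is the boundary component `B u + B' z` of `𝒜` in the new variables `v = u - D z`, `z`.
  let w : K.domain →ₗ[ℂ] Z := B.comp σ + (B' : Z →ₗ[ℂ] Z).comp q
  have hw : ∀ p, w p = B (σ p) + B' (p : X × Z).2 := fun p => rfl
  -- Shearing `𝒜` gives the first component `A (v + D z) - D w = A₀ v + l D z - D w`; the terms
  -- besides `A₀ v` have values in `Y` because `D` does.
  let P : K.domain →ₗ[ℂ] Y × Z :=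
    (l • (D : Z →ₗ[ℂ] Y).comp q - (D : Z →ₗ[ℂ] Y).comp w).prod w
  have hP : ∀ p, P p = (l • D (p : X × Z).2 - D (w p), w p) := fun p => rfl
  have hKP : ∀ p, K p + productEmbedding Z j (P p) = (A (σ p) - j (D (w p)), w p) := fun p => by
    rw [hP, productEmbedding_apply, hσA]
    ext
    · simp only [Prod.fst_add, map_sub, map_smul]; abel
    · simp [hK2]
  have hPle : ∀ p, ‖P p‖ ≤ (‖l‖ * ‖D‖ + ‖D‖ + 1) * (‖(p : X × Z)‖ + ‖w p‖) := fun p => by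
    have h1 : ‖D (p : X × Z).2‖ ≤ ‖D‖ * ‖(p : X × Z)‖ :=
      D.le_opNorm_of_le (norm_snd_le (p : X × Z))
    have h2 : ‖l • D (p : X × Z).2 - D (w p)‖ ≤ ‖l‖ * (‖D‖ * ‖(p : X × Z)‖) + ‖D‖ * ‖w p‖ := by
      refine (norm_sub_le _ _).trans ?_
      rw [norm_smul]
      gcongr
      exact D.le_opNorm _
    rw [hP, Prod.norm_mk]
    have h3 := mul_nonneg (mul_nonneg (norm_nonneg l) (norm_nonneg D)) (norm_nonneg (w p))
    have h4 := mul_nonneg (norm_nonneg D) (norm_nonneg (p : X × Z))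
    have h5 := norm_nonneg (p : X × Z)
    have h6 := mul_nonneg (norm_nonneg D) (norm_nonneg (w p))
    have h7 := mul_nonneg (norm_nonneg l) h4
    have h8 := norm_nonneg (w p)
    refine max_le ?_ ?_ <;> nlinarith
  have hwle : ∀ p, ‖w p‖ ≤ (|c| * (‖j.comp D‖ * (1 + ‖l‖) + 2) + ‖B'‖) *
      (‖(p : X × Z)‖ + ‖K p‖) := fun p => by
    have h1 : ‖(p : X × Z).2‖ ≤ ‖(p : X × Z)‖ := norm_snd_le _
    have h2 : ‖j (D (p : X × Z).2)‖ ≤ ‖j.comp D‖ * ‖(p : X × Z)‖ :=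
      (j.comp D).le_opNorm_of_le h1
    have h3 : ‖((σ p : A.domain) : X)‖ ≤ ‖(p : X × Z)‖ + ‖j.comp D‖ * ‖(p : X × Z)‖ :=
      (norm_add_le _ _).trans (add_le_add (norm_fst_le (p : X × Z)) h2)
    have h4 : ‖A (σ p)‖ ≤ ‖K p‖ + ‖l‖ * (‖j.comp D‖ * ‖(p : X × Z)‖) := by
      rw [hσA]
      refine (norm_add_le _ _).trans (add_le_add (norm_fst_le (K p)) ?_)
      rw [norm_smul]
      gcongr
    have h5 : ‖B' (p : X × Z).2‖ ≤ ‖B'‖ * ‖(p : X × Z)‖ := B'.le_opNorm_of_le h1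
    have h6 : ‖B (σ p)‖ ≤ |c| * (‖(p : X × Z)‖ + ‖j.comp D‖ * ‖(p : X × Z)‖ +
        (‖K p‖ + ‖l‖ * (‖j.comp D‖ * ‖(p : X × Z)‖)) + ‖(p : X × Z)‖) := by
      refine (hc _).trans (mul_le_mul (le_abs_self c) ?_ (by positivity) (abs_nonneg c))
      rw [hσL]
      exact add_le_add (add_le_add h3 h4) h1
    rw [hw]
    refine (norm_add_le _ _).trans ((add_le_add h6 h5).trans ?_)
    have h7 : ‖(p : X × Z)‖ + ‖j.comp D‖ * ‖(p : X × Z)‖ +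
        (‖K p‖ + ‖l‖ * (‖j.comp D‖ * ‖(p : X × Z)‖)) + ‖(p : X × Z)‖ ≤
        (‖j.comp D‖ * (1 + ‖l‖) + 2) * (‖(p : X × Z)‖ + ‖K p‖) := by
      have := mul_nonneg (mul_nonneg (norm_nonneg (j.comp D))
        (show 0 ≤ 1 + ‖l‖ by positivity)) (norm_nonneg (K p))
      nlinarith [norm_nonneg (K p)]
    have h8 := mul_le_mul_of_nonneg_left h7 (abs_nonneg c)
    have h9 := mul_nonneg (norm_nonneg B') (norm_nonneg (K p))
    linarith
  set C₁ := ‖l‖ * ‖D‖ + ‖D‖ + 1 with hC₁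
  have hC₁0 : 0 ≤ C₁ := by positivity
  set C₂ := |c| * (‖j.comp D‖ * (1 + ‖l‖) + 2) + ‖B'‖ with hC₂
  have hpert := exists_isReductionGroup_addOnDomain_iff (K := K) (i := productEmbedding Z j)
    (productEmbedding_injective Z hj) P (C₁ * (1 + C₂)) C₁
    (fun p => by
      have h2 : ‖(p : X × Z)‖ + ‖w p‖ ≤ (1 + C₂) * (‖(p : X × Z)‖ + ‖K p‖) := by
        linarith [hwle p, norm_nonneg (K p)]
      calc ‖P p‖ ≤ C₁ * (‖(p : X × Z)‖ + ‖w p‖) := hPle p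
        _ ≤ C₁ * ((1 + C₂) * (‖(p : X × Z)‖ + ‖K p‖)) := by gcongr
        _ = _ := by ring)
    (fun p => by
      refine (hPle p).trans ?_
      -- The second component of the perturbed operator is `w` itself, so its graph norm dominates
      -- `P` with no further estimate.
      have h1 : ‖w p‖ ≤ ‖K p + productEmbedding Z j (P p)‖ := by
        rw [hKP]; exact norm_snd_le (A (σ p) - j (D (w p)), w p)
      gcongr)
  rw [← exists_isReductionGroup_diagZero_iff (K := kerRestrict A L) (j := j) (Z := Z), ← hK, ← hpert]
  -- `u - D z` lies in `D(A₀)` exactly when `u ∈ D(A)` and `L u = z`: the shear removes the coupling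
  -- from the domain.
  have hsim : ∀ x y : X × Z, (shear (j.comp D) x, shear (j.comp D) y) ∈
      (addOnDomain K (productEmbedding Z j) P).graph ↔ (x, y) ∈ (coupledMatrix A L B B').graph := by
    rintro ⟨u, z⟩ ⟨a, b⟩
    have hshear : ∀ x z, shear (j.comp D) (x, z) = (x - j (D z), z) := fun _ _ => rfl
    rw [hshear, hshear, mem_graph_coupledMatrix, mem_graph_addOnDomain]
    have hshift : ∀ h : (u - j (D z), z) ∈ K.domain,
        ((σ ⟨(u - j (D z), z), h⟩ : A.domain) : X) = u := fun h => sub_add_cancel _ _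
    constructor
    · rintro ⟨h, he⟩
      rw [hKP] at he
      obtain ⟨h1, h2⟩ := Prod.ext_iff.1 he
      simp only at h1 h2
      have hu : u ∈ A.domain := by rw [← hshift h]; exact Subtype.property _
      have h3 : σ ⟨(u - j (D z), z), h⟩ = ⟨u, hu⟩ := Subtype.ext (hshift h)
      have h4 := hσL ⟨(u - j (D z), z), h⟩
      rw [h3] at h1 h4
      rw [h2] at h1
      rw [hw, h3] at h2
      exact ⟨hu, h4, sub_left_injective h1, h2⟩
    · rintro ⟨hu, hLu, hAu, hBu⟩
      have h0 : (u - j (D z), z) ∈ K.domain := by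
        have h1 : (u - j (D z), A ⟨u, hu⟩ - A ⟨_, (hD z).1⟩) ∈ (kerRestrict A L).graph :=
          mem_graph_kerRestrict.2 ⟨A.domain.sub_mem hu (hD z).1,
            LinearPMap.map_sub A ⟨u, hu⟩ ⟨_, (hD z).1⟩, by
            have := map_sub L ⟨u, hu⟩ ⟨_, (hD z).1⟩
            rw [hLu, (hD z).2.2, sub_self] at this
            exact this⟩
        exact show u - j (D z) ∈ (kerRestrict A L).domain from
          LinearPMap.mem_domain_of_mem_graph h1
      refine ⟨h0, ?_⟩
      have h3 : σ ⟨(u - j (D z), z), h0⟩ = ⟨u, hu⟩ := Subtype.ext (hshift h0)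
      have h4 : w ⟨(u - j (D z), z), h0⟩ = b := by rw [hw, h3]; exact hBu
      rw [hKP, h3, h4, hAu]
  constructor
  · rintro ⟨U, hU⟩
    exact hU.exists_conj (shear (j.comp D)) (shear D)
      (fun f => by ext <;> simp [productEmbedding, shear]) hsim
  · rintro ⟨U, hU⟩
    refine hU.exists_conj (shear (j.comp D)).symm (shear D).symm (fun f => ?_) fun x y => ?_
    · rw [ContinuousLinearEquiv.symm_apply_eq]
      obtain ⟨f, rfl⟩ := (shear D).surjective f
      rw [ContinuousLinearEquiv.symm_apply_apply]
      ext <;> simp [productEmbedding, shear]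
    · rw [← hsim]; simp

theorem isClassicalSolution_coupledMatrix_iff {u : ℝ → Y} {x : ℝ → Z} :
    IsClassicalSolution (coupledMatrix A L B B') (productEmbedding Z j) (fun t => (u t, x t)) ↔
      IsClassicalSolutionDyn A L B B' j u x := by
  have hd : ContDiff ℝ 2 (fun t => j (u t)) → ContDiff ℝ 2 x →
      (deriv (deriv fun s => productEmbedding Z j (u s, x s))) =
        fun t => (deriv (deriv fun s => j (u s)) t, deriv (deriv x) t) := by
    intro h1 h2
    have h1' : ContDiff ℝ 1 (deriv fun t => j (u t)) := by
      rw [← one_add_one_eq_two] at h1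
      exact (contDiff_succ_iff_deriv.1 h1).2.2
    have h2' : ContDiff ℝ 1 (deriv x) := by
      rw [← one_add_one_eq_two] at h2
      exact (contDiff_succ_iff_deriv.1 h2).2.2
    have h3 : (deriv fun s => productEmbedding Z j (u s, x s)) =
        fun t => (deriv (fun s => j (u s)) t, deriv x t) := by
      funext t
      exact ((h1.differentiable two_ne_zero t).hasDerivAt.prodMk
        (h2.differentiable two_ne_zero t).hasDerivAt).deriv
    rw [h3]
    funext t
    exact ((h1'.differentiable one_ne_zero t).hasDerivAt.prodMk
      (h2'.differentiable one_ne_zero t).hasDerivAt).deriv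
  constructor
  · intro h
    have h1 : ContDiff ℝ 2 (fun t => j (u t)) := contDiff_fst.comp h.contDiff_two
    have h2 : ContDiff ℝ 2 x := contDiff_snd.comp h.contDiff_two
    refine ⟨contDiff_fst.comp h.contDiff_one, h1, h2, fun t => ?_⟩
    obtain ⟨h3, h4⟩ := h.equation t
    rw [hd h1 h2] at h4
    obtain ⟨h5, h6⟩ := Prod.ext_iff.1 h4
    exact ⟨h3.1, h3.2.symm, h5, h6⟩
  · intro h
    refine ⟨h.contDiff_one.prodMk (h.contDiff_boundary.of_le one_le_two),
      h.contDiff_two.prodMk h.contDiff_boundary, fun t => ?_⟩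
    obtain ⟨h1, h2, h3, h4⟩ := h.equation t
    refine ⟨⟨h1, h2.symm⟩, ?_⟩
    rw [hd h.contDiff_two h.contDiff_boundary]
    exact Prod.ext h3 h4

theorem IsClassicalSolutionDyn.deriv_prodMk {u : ℝ → Y} {x : ℝ → Z}
    (h : IsClassicalSolutionDyn A L B B' j u x) (t : ℝ) :
    deriv (fun t => (u t, x t)) t = (deriv u t, deriv x t) :=
  ((h.contDiff_one.differentiable one_ne_zero t).hasDerivAt.prodMk
    (h.contDiff_boundary.differentiable two_ne_zero t).hasDerivAt).deriv

theorem IsClassicalSolutionDyn.boundary_eq {u : ℝ → Y} {x x' : ℝ → Z}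
    (h : IsClassicalSolutionDyn A L B B' j u x) (h' : IsClassicalSolutionDyn A L B B' j u x') :
    x = x' := by
  funext t
  obtain ⟨h1, h2, -⟩ := h.equation t
  obtain ⟨h3, h4, -⟩ := h'.equation t
  rw [h2, h4]

/-- The boundary curve is determined by `u` as `L u`, so uniqueness of `u` and of the pair `(u, x)`
agree. The sum and product norms differ only by constants. -/
theorem isWellPosed_coupledMatrix_iff :
    IsWellPosed (coupledMatrix A L B B') (productEmbedding Z j) ↔ IsWellPosedDyn A L B B' j := by
  constructor
  · rintro ⟨h1, h2⟩
    refine ⟨?_, fun r => ?_⟩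
    · rintro f g h k hf
      obtain ⟨v, ⟨hv, hv0, hv1⟩, hvu⟩ := h1 ⟨((f : X), h), f.2, hf⟩ (g, k)
      have hv' : IsClassicalSolutionDyn A L B B' j (fun t => (v t).1) (fun t => (v t).2) :=
        isClassicalSolution_coupledMatrix_iff.1 hv
      have hd : deriv v 0 = _ := hv'.deriv_prodMk 0
      rw [hv1] at hd
      refine ⟨fun t => (v t).1, ⟨fun t => (v t).2, hv', congrArg Prod.fst hv0,
        (congrArg Prod.fst hd).symm, congrArg Prod.snd hv0, (congrArg Prod.snd hd).symm⟩, ?_⟩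
      rintro u ⟨x, hu, hu0, hu1, hx0, hx1⟩
      have := hvu (fun t => (u t, x t)) ⟨isClassicalSolution_coupledMatrix_iff.2 hu,
        Prod.ext hu0 hx0, by rw [hu.deriv_prodMk, hu1, hx1]⟩
      rw [← this]
    · obtain ⟨M, hM⟩ := h2 r
      refine ⟨2 * |M|, fun u x hu t ht => ?_⟩
      have h3 := hM _ (isClassicalSolution_coupledMatrix_iff.2 hu) t ht
      rw [hu.deriv_prodMk, hu.deriv_prodMk, productEmbedding_apply, productEmbedding_apply] at h3
      have h4 := norm_fst_le (u t, x t)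
      have h5 := norm_snd_le (u t, x t)
      have h6 := norm_fst_le (j (deriv u t), deriv x t)
      have h7 := norm_snd_le (j (deriv u t), deriv x t)
      simp only at h4 h5 h6 h7
      have h8 : ‖(u 0, x 0)‖ ≤ ‖u 0‖ + ‖x 0‖ :=
        max_le_add_of_nonneg (norm_nonneg _) (norm_nonneg _)
      have h9 : ‖(j (deriv u 0), deriv x 0)‖ ≤ ‖j (deriv u 0)‖ + ‖deriv x 0‖ :=
        max_le_add_of_nonneg (norm_nonneg _) (norm_nonneg _)
      have h10 : M * (‖(u 0, x 0)‖ + ‖(j (deriv u 0), deriv x 0)‖) ≤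
          |M| * (‖u 0‖ + ‖j (deriv u 0)‖ + ‖x 0‖ + ‖deriv x 0‖) :=
        mul_le_mul (le_abs_self M) (by linarith) (by positivity) (abs_nonneg M)
      linarith
  · rintro ⟨h1, h2⟩
    refine ⟨?_, fun r => ?_⟩
    · rintro ⟨⟨f, h⟩, hf, hfh⟩ ⟨g, k⟩
      obtain ⟨u, ⟨x, hu, hu0, hu1, hx0, hx1⟩, huu⟩ := h1 ⟨f, hf⟩ g h k hfh
      refine ⟨fun t => (u t, x t), ⟨isClassicalSolution_coupledMatrix_iff.2 hu,
        Prod.ext hu0 hx0, by rw [hu.deriv_prodMk, hu1, hx1]⟩, ?_⟩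
      rintro v ⟨hv, hv0, hv1⟩
      have hv' : IsClassicalSolutionDyn A L B B' j (fun t => (v t).1) (fun t => (v t).2) :=
        isClassicalSolution_coupledMatrix_iff.1 hv
      have hd : deriv v 0 = _ := hv'.deriv_prodMk 0
      rw [hv1] at hd
      have h3 : (fun t => (v t).1) = u := huu _ ⟨_, hv', congrArg Prod.fst hv0,
        (congrArg Prod.fst hd).symm, congrArg Prod.snd hv0, (congrArg Prod.snd hd).symm⟩
      rw [h3] at hv'
      have h4 := hv'.boundary_eq hu
      funext t
      exact Prod.ext (congrFun h3 t) (congrFun h4 t)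
    · obtain ⟨M, hM⟩ := h2 r
      refine ⟨|M| * 2, fun v hv t ht => ?_⟩
      have hv' : IsClassicalSolutionDyn A L B B' j (fun t => (v t).1) (fun t => (v t).2) :=
        isClassicalSolution_coupledMatrix_iff.1 hv
      have hd : ∀ t, deriv v t = _ := hv'.deriv_prodMk
      have h3 := hM _ _ hv' t ht
      rw [hd, hd, productEmbedding_apply, productEmbedding_apply]
      set a := deriv (fun t => (v t).1)
      set b := deriv (fun t => (v t).2)
      have h4 : ‖v t‖ ≤ ‖(v t).1‖ + ‖(v t).2‖ :=
        max_le_add_of_nonneg (norm_nonneg _) (norm_nonneg _)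
      have h5 : ‖(j (a t), b t)‖ ≤ ‖j (a t)‖ + ‖b t‖ :=
        max_le_add_of_nonneg (norm_nonneg _) (norm_nonneg _)
      have h6 := norm_fst_le (v 0)
      have h7 := norm_snd_le (v 0)
      have h8 := norm_fst_le (j (a 0), b 0)
      have h9 := norm_snd_le (j (a 0), b 0)
      simp only at h8 h9
      have h10 : M * (‖(v 0).1‖ + ‖j (a 0)‖ + ‖(v 0).2‖ + ‖b 0‖) ≤
          |M| * (2 * (‖v 0‖ + ‖(j (a 0), b 0)‖)) :=
        mul_le_mul (le_abs_self M) (by linarith) (by positivity) (abs_nonneg M)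
      linarith

end BoundaryOperators

end DynBdry

/-! ### The main theorem -/

open DynBdry in
theorem theorem4p1
    {X Y Z : Type*}
    [NormedAddCommGroup X] [NormedSpace ℂ X] [CompleteSpace X]
    [NormedAddCommGroup Y] [NormedSpace ℂ Y] [CompleteSpace Y]
    [NormedAddCommGroup Z] [NormedSpace ℂ Z] [CompleteSpace Z]
    -- the continuous imbedding of `Y` into `X`
    (j : Y →L[ℂ] X) (hj : Function.Injective j)
    -- the operator `A`, with `D(A) ⊆ Y`
    (A : X →ₗ.[ℂ] X) (hAY : ∀ u ∈ A.domain, ∃ y : Y, j y = u)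
    -- the boundary operator `L`, onto the boundary space `Z`
    (L : A.domain →ₗ[ℂ] Z) (hL : Function.Surjective L)
    (hA₀_closed : (kerRestrict A L).IsClosed)
    (hA₀_dense : Dense ((kerRestrict A L).domain : Set X))
    (hA₀_res : (DynBdry.resolventSet (kerRestrict A L)).Nonempty)
    (hAL_closed : (pairOp A L).IsClosed)
    -- `B` is bounded for the graph norm of `(A, L)`, and `B'` is bounded on `Z`
    (B : A.domain →ₗ[ℂ] Z)
    (hB : ∃ c : ℝ, ∀ u : A.domain, ‖B u‖ ≤ c * (‖(u : X)‖ + ‖A u‖ + ‖L u‖))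
    (B' : Z →L[ℂ] Z)
    -- `L` is not bounded from `Y` to `Z`
    (hL_unbdd : ¬ ∃ c : ℝ, ∀ (u : A.domain) (y : Y), j y = u → ‖L u‖ ≤ c * ‖y‖) :
    (GeneratesCosineWithPhaseSpace (coupledMatrix A L B B')
        (productEmbedding Z j) (productEmbedding_injective Z hj) ↔
      GeneratesCosineWithPhaseSpace (kerRestrict A L) j hj) ∧
    (GeneratesCosineWithPhaseSpace (coupledMatrix A L B B')
        (productEmbedding Z j) (productEmbedding_injective Z hj) ↔
      IsWellPosedDyn A L B B' j) ∧
    (GeneratesCosineWithPhaseSpace (kerRestrict A L) j hj ↔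
      IsWellPosed (kerRestrict A L) j) := by
  have hA₀_dom : ∀ u ∈ (kerRestrict A L).domain, ∃ y : Y, j y = u := fun u hu => hAY u hu.2
  have hdom : ∀ p ∈ (coupledMatrix A L B B').domain, ∃ q : Y × Z, productEmbedding Z j q = p := by
    rintro ⟨u, z⟩ ⟨hu, -⟩
    obtain ⟨y, rfl⟩ := hAY u hu
    exact ⟨(y, z), rfl⟩
  have hclosed : (coupledMatrix A L B B').IsClosed := isClosed_coupledMatrix hAL_closed hB
  -- Density of `D(A₀)` in `X` supplies the dense range needed to pass from well-posedness to a
  -- group.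
  have hj_dense : DenseRange j := hA₀_dense.mono hA₀_dom
  have hprod_dense : DenseRange (productEmbedding Z j) := hj_dense.prodMap denseRange_id
  refine ⟨?_, ?_, ?_⟩
  · rw [generatesCosineWithPhaseSpace_iff hclosed hdom,
      generatesCosineWithPhaseSpace_iff hA₀_closed hA₀_dom]
    exact exists_isReductionGroup_coupledMatrix_iff hj hAY hL hA₀_res hAL_closed hB
  · rw [generatesCosineWithPhaseSpace_iff_isWellPosed hclosed hdom hprod_dense]
    exact isWellPosed_coupledMatrix_iff
  · exact generatesCosineWithPhaseSpace_iff_isWellPosed hA₀_closed hA₀_dom hj_dense
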